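/- **Setting.** Consider a two-agent MDP with finite nonempty state set $S$, finite nonempty action sets $A_1,A_2$, transition kernel $P$ and joint reward $r:S\times A_1\times A_2\to[0,1]$. A policy of agent $i$ is a matrix $\pi^i(s,a)$ whose rows $\pi^i(s)$ are probability distributions on $A_i$. $P_{\pi^1,\pi^2}$ is the induced state transition matrix. For matrices, $\|B\|_\infty=\max_s\sum_j|B(s,j)|$. Assume that there is a mixing time $\omega>0$: for all policies $\pi^1,\pi^2$ and all state distributions $d,d'$, $$\|dP_{\pi^1,\pi^2}-d'P_{\pi^1,\pi^2}\|_1\le e^{-1/\omega}\|d-d'\|_1 .$$ Let $d_{\pi^1,\pi^2}$ be the stationary distribution of $P_{\pi^1,\pi^2}$, which every initial state distribution converges to. Agent 2 plays arbitrary policies $\pi^2_1,\dots,\pi^2_T$ in episodes $1,\dots,T$, and agent 1 plays $\pi^1_1,\dots,\pi^1_T$. Put $r_t(s,a)=\mathbb E_{b\sim\pi^2_t(s)}[r(s,a,b)]$ and $\eta_t(\pi^1)=\sum_s d_{\pi^1,\pi^2_t}(s)\sum_a\pi^1(s,a)r_t(s,a)$. Let $$Q_t(s,a)=\sum_{m=1}^\infty\big(\mathbb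 E[r_t(s_m,a_m)]-\eta_t(\pi^1_t)\big),$$ where $s_1=s$, $a_1=a$, agent 1 follows $\pi^1_t$ from round 2 on and agent 2 follows $\pi^2_t$; put $Q_t=0$ for $t<1$. The regret is $$R(T)=\sup_{\pi^1}\sum_{t=1}^T\big(\eta_t(\pi^1)-\eta_t(\pi^1_t)\big).$$ The policy change magnitudes are $\rho_i=\max_{1<t\le T}\|\pi^i_t-\pi^i_{t-1}\|_\infty$ (and $0$ if $T=1$), and the influence of agent 2 is $$I_2=\sup_{\pi^1,\ \pi^2\ne\pi^{2\prime}}\frac{\|P_{\pi^1,\pi^2}-P_{\pi^1,\pi^{2\prime}}\|_\infty}{\|\pi^2-\pi^{2\prime}\|_\infty}$$ (with $I_2=0$ if agent 2 has only one policy). **Algorithm ExpDRBias.** Let $\mathcal P_{A_1}$ be the simplex of probability distributions on $A_1$, let $\mathcal R$ be a regularizer on $\mathcal P_{A_1}$ that is $1$-strongly convex with respect to the $\ell^1$ norm, and put $\Delta_{\mathcal R}=\sup_{\mathcal P_{A_1}}\mathcal R-\inf_{\mathcal P_{A_1}}\mathcal R$. With window length $\Gamma\in\mathbb N$, $1\le\Gamma\le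 T$, and learning rate $\epsilon>0$, agent 1 plays, in every episode $1\le t\le T$ and every state $s$, $$\pi^1_t(s)=\frac1\Gamma\sum_{\tau=1}^{\Gamma}w_{t,\tau}(s),\qquad w_{t,\tau}(s)\in\arg\max_{w\in\mathcal P_{A_1}}\Big\langle\sum_{j=1}^{\tau-1}Q_{t-j}(s,\cdot)+Q_{t-1}(s,\cdot),\,w\Big\rangle-\frac{\mathcal R(w)}{\epsilon}.$$ **Constants.** Put $$C_{Q^\pi}=\frac{3(\rho_1+I_2\rho_2)}{(1-e^{-1/\omega})^2}+\frac{2(\rho_1+\rho_2)}{1-e^{-1/\omega}},$$ $$C_Q=C_{Q^\pi}+\Big(\frac{3}{1-e^{-1/\omega}}+1\Big)\rho_1+2\rho_2+\frac{\rho_1+I_2\rho_2}{1-e^{-1/\omega}},$$ and let $C_\omega$ be any real number with $C_\omega\ge C_Q/\max\{\rho_1,\rho_2\}$ (with $C_\omega\ge1$ if $\rho_1=\rho_2=0$). **Theorem.** Let the learning rate of ExpDRBias be $\epsilon=\Gamma^{-1/4}$ and let $k>0$ be such that $\rho_1\le k\epsilon$ and $\rho_2\le k\epsilon$. Then the regret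 of ExpDRBias satisfies $$R(T)\le 2\big(\Delta_{\mathcal R}+k^2C_\omega^2\big)\,T\,\Gamma^{-3/4}+\frac{6\,I_2\,\rho_2}{(1-e^{-1/\omega})^2}\,T\,\Gamma .$$ -/

import Mathlib

noncomputable section

open scoped Matrix

/-- A finite two-agent MDP with a joint reward in `[0, 1]`. -/
structure TwoAgentMDP (S A₁ A₂ : Type*) [Fintype S] where
  /-- transition kernel: `P s a b s'` is the probability of moving from `s` to `s'`
  under the joint action `(a, b)` -/
  P : S → A₁ → A₂ → S → ℝ
  P_mem : ∀ s a b, P s a b ∈ stdSimplex ℝ S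
  /-- joint reward -/
  r : S → A₁ → A₂ → ℝ
  r_mem : ∀ s a b, r s a b ∈ Set.Icc (0 : ℝ) 1

/-- A stationary policy: every row is a probability distribution on the actions. -/
def IsPolicy {S A : Type*} [Fintype A] (p : S → A → ℝ) : Prop :=
  ∀ s, p s ∈ stdSimplex ℝ A

/-- The `ℓ¹` norm of a vector. -/
def l1Norm {ι : Type*} [Fintype ι] (v : ι → ℝ) : ℝ := ∑ i, |v i|

/-- The operator norm of a matrix induced by the sup norm: the largest `ℓ¹` norm of a row. -/
def rowNorm {ι κ : Type*} [Fintype κ] (B : ι → κ → ℝ) : ℝ := ⨆ i, l1Norm (B i)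

/-- Policy change magnitude of a sequence of policies over the episodes `1, …, T`: the largest
`‖p_t - p_{t-1}‖_∞` with `1 < t ≤ T` (it is `0` if `T ≤ 1`). -/
def policyChange {S A : Type*} [Fintype A] (T : ℕ) (p : ℕ → S → A → ℝ) : ℝ :=
  sSup {x | ∃ t, 1 < t ∧ t ≤ T ∧ x = rowNorm (p t - p (t - 1))}

namespace TwoAgentMDP

section

variable {S A₁ A₂ : Type*} [Fintype S] [Fintype A₁] [Fintype A₂]

/-- `P_{π²}(s, a¹)`: the distribution of the next state when the first agent plays `a` in `s`
and the second agent follows `p₂`. -/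
def nextDist (M : TwoAgentMDP S A₁ A₂) (p₂ : S → A₂ → ℝ) (s : S) (a : A₁) : S → ℝ :=
  fun s' => ∑ b, p₂ s b * M.P s a b s'

/-- State transition matrix `P_{π¹,π²}`. -/
def transMat (M : TwoAgentMDP S A₁ A₂) (p₁ : S → A₁ → ℝ) (p₂ : S → A₂ → ℝ) : Matrix S S ℝ :=
  fun s s' => ∑ a, p₁ s a * M.nextDist p₂ s a s'

/-- Expected reward matrix of the first agent when the second agent follows `p₂`. -/
def expReward (M : TwoAgentMDP S A₁ A₂) (p₂ : S → A₂ → ℝ) (s : S) (a : A₁) : ℝ :=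
  ∑ b, p₂ s b * M.r s a b

/-- Row-wise dot product of `p₁` with the expected reward matrix. -/
def policyReward (M : TwoAgentMDP S A₁ A₂) (p₁ : S → A₁ → ℝ) (p₂ : S → A₂ → ℝ) : S → ℝ :=
  fun s => ∑ a, p₁ s a * M.expReward p₂ s a

/-- Influence `I₂` of the second agent on the transitions. The quotients lie in `[0, 1]`; if the
second agent has only one policy the value is `0`. -/
def influence₂ (M : TwoAgentMDP S A₁ A₂) : ℝ :=
  sSup {x | ∃ (p₁ : S → A₁ → ℝ) (p₂ p₂' : S → A₂ → ℝ),
    IsPolicy p₁ ∧ IsPolicy p₂ ∧ IsPolicy p₂' ∧ p₂ ≠ p₂' ∧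
      x = rowNorm (M.transMat p₁ p₂ - M.transMat p₁ p₂') / rowNorm (p₂ - p₂')}

/-- `ω` is a mixing time: for all pairs of policies, one step of the chain contracts the `ℓ¹`
distance of state distributions by the factor `exp (-1/ω)`. -/
def HasMixingTime (M : TwoAgentMDP S A₁ A₂) (ω : ℝ) : Prop :=
  0 < ω ∧ ∀ (p₁ : S → A₁ → ℝ) (p₂ : S → A₂ → ℝ), IsPolicy p₁ → IsPolicy p₂ →
    ∀ d ∈ stdSimplex ℝ S, ∀ d' ∈ stdSimplex ℝ S,
      l1Norm (d ᵥ* M.transMat p₁ p₂ - d' ᵥ* M.transMat p₁ p₂)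
        ≤ Real.exp (-(1 / ω)) * l1Norm (d - d')

variable [DecidableEq S]

/-- `d` is the stationary state distribution of `(p₁, p₂)`: it is invariant, and every initial
state distribution converges to it. -/
def IsStationary (M : TwoAgentMDP S A₁ A₂) (p₁ : S → A₁ → ℝ) (p₂ : S → A₂ → ℝ)
    (d : S → ℝ) : Prop :=
  d ∈ stdSimplex ℝ S ∧ d ᵥ* M.transMat p₁ p₂ = d ∧
    ∀ d₀ ∈ stdSimplex ℝ S,
      Filter.Tendsto (fun n : ℕ => d₀ ᵥ* (M.transMat p₁ p₂) ^ n) Filter.atTop (nhds d)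

open Classical in
/-- The stationary state distribution of `(p₁, p₂)`; see `isStationary_statDist`. -/
def statDist (M : TwoAgentMDP S A₁ A₂) (p₁ : S → A₁ → ℝ) (p₂ : S → A₂ → ℝ) : S → ℝ :=
  if h : ∃ d, M.IsStationary p₁ p₂ d then h.choose else 0

/-- Average reward `η_{π²}(π¹)`. -/
def avgReward (M : TwoAgentMDP S A₁ A₂) (p₁ : S → A₁ → ℝ) (p₂ : S → A₂ → ℝ) : ℝ :=
  M.statDist p₁ p₂ ⬝ᵥ M.policyReward p₁ p₂

/-- Expected reward in round `m + 1` when round `1` starts in state `s` with action `a` of the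
first agent, the first agent then follows `p₁`, and the second agent follows `p₂` throughout. -/
def roundReward (M : TwoAgentMDP S A₁ A₂) (p₁ : S → A₁ → ℝ) (p₂ : S → A₂ → ℝ)
    (s : S) (a : A₁) : ℕ → ℝ
  | 0 => M.expReward p₂ s a
  | m + 1 => (M.nextDist p₂ s a ᵥ* (M.transMat p₁ p₂) ^ m) ⬝ᵥ M.policyReward p₁ p₂

/-- `Q`-values of the first agent with respect to `(p₁, p₂)`. -/
def qValue (M : TwoAgentMDP S A₁ A₂) (p₁ : S → A₁ → ℝ) (p₂ : S → A₂ → ℝ)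
    (s : S) (a : A₁) : ℝ :=
  ∑' m : ℕ, (M.roundReward p₁ p₂ s a m - M.avgReward p₁ p₂)

/-- The `Q`-values `Q_t` along sequences of policies indexed by the episodes `1, 2, …`;
before the first episode they are `0`. -/
def qSeq (M : TwoAgentMDP S A₁ A₂) (π₁ : ℕ → S → A₁ → ℝ) (π₂ : ℕ → S → A₂ → ℝ) :
    ℕ → S → A₁ → ℝ
  | 0 => 0
  | t + 1 => M.qValue (π₁ (t + 1)) (π₂ (t + 1))

/-- Regret `R(T)` of the first agent. -/
def regret (M : TwoAgentMDP S A₁ A₂) (T : ℕ) (π₁ : ℕ → S → A₁ → ℝ)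
    (π₂ : ℕ → S → A₂ → ℝ) : ℝ :=
  sSup {x | ∃ p : S → A₁ → ℝ, IsPolicy p ∧
    x = ∑ t ∈ Finset.Icc 1 T, (M.avgReward p (π₂ t) - M.avgReward (π₁ t) (π₂ t))}

/-- Against the policies `π₂` of the second agent, `π₁` is the sequence of policies played by
ExpDRBias with regularizer `R`, learning rate `ε` and window length `Γ` in the episodes
`1, …, T`: in every state, `π₁ t` averages the weights `w t τ`, `1 ≤ τ ≤ Γ`, where `w t τ`
is the optimistic follow-the-regularized-leader choice that uses the `τ - 1` most recent `Q`-values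
and counts `Q_{t-1}` once more as the prediction of `Q_t`. The truncated subtraction `t - j` is
intended: `Q`-values before the first episode are `0`. -/
def IsExpDRBias (M : TwoAgentMDP S A₁ A₂) (R : (A₁ → ℝ) → ℝ) (ε : ℝ) (Γ T : ℕ)
    (π₁ : ℕ → S → A₁ → ℝ) (π₂ : ℕ → S → A₂ → ℝ) : Prop :=
  ∃ w : ℕ → ℕ → S → A₁ → ℝ, ∀ t ∈ Finset.Icc 1 T, ∀ s,
    (∀ τ ∈ Finset.Icc 1 Γ,
      w t τ s ∈ stdSimplex ℝ A₁ ∧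
      IsMaxOn (fun v : A₁ → ℝ =>
          ((∑ j ∈ Finset.Icc 1 (τ - 1), M.qSeq π₁ π₂ (t - j) s) + M.qSeq π₁ π₂ (t - 1) s) ⬝ᵥ v
            - R v / ε)
        (stdSimplex ℝ A₁) (w t τ s)) ∧
    π₁ t s = (1 / (Γ : ℝ)) • ∑ τ ∈ Finset.Icc 1 Γ, w t τ s

/-- Under a mixing time the stationary distribution exists, so `statDist` is what it should be. -/
theorem isStationary_statDist [Nonempty S] (M : TwoAgentMDP S A₁ A₂) {ω : ℝ}
    (hM : M.HasMixingTime ω) {p₁ : S → A₁ → ℝ} {p₂ : S → A₂ → ℝ}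
    (h₁ : IsPolicy p₁) (h₂ : IsPolicy p₂) :
    M.IsStationary p₁ p₂ (M.statDist p₁ p₂) := by
  have key : ∃ d, M.IsStationary p₁ p₂ d := by
    set B := M.transMat p₁ p₂ with hB
    have hn : ∀ s a, M.nextDist p₂ s a ∈ stdSimplex ℝ S := by
      intro s a
      refine ⟨fun s' => Finset.sum_nonneg fun b _ =>
        mul_nonneg ((h₂ s).1 b) ((M.P_mem s a b).1 s'), ?_⟩
      simp only [nextDist]
      rw [Finset.sum_comm]
      simp only [← Finset.mul_sum, (M.P_mem s a _).2, mul_one, (h₂ s).2]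
    have hrow : ∀ s, B s ∈ stdSimplex ℝ S := by
      intro s
      refine ⟨fun s' => Finset.sum_nonneg fun a _ =>
        mul_nonneg ((h₁ s).1 a) ((hn s a).1 s'), ?_⟩
      simp only [hB, transMat]
      rw [Finset.sum_comm]
      simp only [← Finset.mul_sum, (hn s _).2, mul_one, (h₁ s).2]
    have hstep : ∀ d ∈ stdSimplex ℝ S, d ᵥ* B ∈ stdSimplex ℝ S := by
      intro d hd
      refine ⟨fun s' => Finset.sum_nonneg fun s _ =>
        mul_nonneg (hd.1 s) ((hrow s).1 s'), ?_⟩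
      simp only [Matrix.vecMul, dotProduct]
      rw [Finset.sum_comm]
      simp only [← Finset.mul_sum, (hrow _).2, mul_one, hd.2]
    have hpow : ∀ d ∈ stdSimplex ℝ S, ∀ n : ℕ, d ᵥ* B ^ n ∈ stdSimplex ℝ S := by
      intro d hd n
      induction n with
      | zero => simpa using hd
      | succ n ih => rw [pow_succ, ← Matrix.vecMul_vecMul]; exact hstep _ ih
    set q := Real.exp (-(1 / ω)) with hq
    have hq0 : 0 ≤ q := (Real.exp_pos _).le
    have hq1 : q < 1 := by
      rw [hq, Real.exp_lt_one_iff]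
      have := one_div_pos.mpr hM.1
      linarith
    have hcon : ∀ d ∈ stdSimplex ℝ S, ∀ d' ∈ stdSimplex ℝ S, ∀ n : ℕ,
        l1Norm (d ᵥ* B ^ n - d' ᵥ* B ^ n) ≤ l1Norm (d - d') * q ^ n := by
      intro d hd d' hd' n
      induction n with
      | zero => simp
      | succ n ih =>
        rw [pow_succ, ← Matrix.vecMul_vecMul, ← Matrix.vecMul_vecMul]
        calc _ ≤ q * l1Norm (d ᵥ* B ^ n - d' ᵥ* B ^ n) :=
              hM.2 p₁ p₂ h₁ h₂ _ (hpow d hd n) _ (hpow d' hd' n)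
          _ ≤ q * (l1Norm (d - d') * q ^ n) := mul_le_mul_of_nonneg_left ih hq0
          _ = _ := by ring
    have hle : ∀ v : S → ℝ, ‖v‖ ≤ l1Norm v := by
      intro v
      refine (pi_norm_le_iff_of_nonneg (Finset.sum_nonneg fun _ _ => abs_nonneg _)).2 ?_
      intro i
      exact Finset.single_le_sum (f := fun j => |v j|) (fun _ _ => abs_nonneg _)
        (Finset.mem_univ i)
    obtain ⟨s₀⟩ := ‹Nonempty S›
    have he : Pi.single s₀ (1 : ℝ) ∈ stdSimplex ℝ S := single_mem_stdSimplex ℝ s₀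
    set e : S → ℝ := Pi.single s₀ (1 : ℝ)
    have hcau : CauchySeq (fun n : ℕ => e ᵥ* B ^ n) := by
      refine cauchySeq_of_le_geometric q (l1Norm (e - e ᵥ* B)) hq1 ?_
      intro n
      rw [dist_eq_norm, pow_succ', ← Matrix.vecMul_vecMul]
      exact (hle _).trans (hcon e he _ (hstep e he) n)
    obtain ⟨d, hd⟩ := cauchySeq_tendsto_of_complete hcau
    have hdm : d ∈ stdSimplex ℝ S :=
      (isClosed_stdSimplex ℝ S).mem_of_tendsto hd (Filter.Eventually.of_forall (hpow e he))
    refine ⟨d, hdm, ?_, ?_⟩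
    · have hc : Continuous (fun v : S → ℝ => v ᵥ* B) := by fun_prop
      have t1 := (hc.tendsto d).comp hd
      have t2 := hd.comp (Filter.tendsto_add_atTop_nat 1)
      refine tendsto_nhds_unique t1 (t2.congr fun n => ?_)
      simp [Function.comp, pow_succ, Matrix.vecMul_vecMul]
    · intro d₀ hd₀
      have hz : Filter.Tendsto (fun n : ℕ => d₀ ᵥ* B ^ n - e ᵥ* B ^ n) Filter.atTop (nhds 0) := by
        refine squeeze_zero_norm (fun n => (hle _).trans (hcon d₀ hd₀ e he n)) ?_
        simpa using (tendsto_pow_atTop_nhds_zero_of_lt_one hq0 hq1).const_mul (l1Norm (d₀ - e))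
      simpa using hz.add hd
  unfold statDist
  rw [dif_pos key]
  exact key.choose_spec

end

end TwoAgentMDP

/-- `R` is `1`-strongly convex on the probability simplex with respect to the `ℓ¹` norm. -/
def IsRegularizer {A : Type*} [Fintype A] (R : (A → ℝ) → ℝ) : Prop :=
  StrongConvexOn {x : PiLp 1 (fun _ : A => ℝ) | WithLp.ofLp x ∈ stdSimplex ℝ A} 1
    (fun x => R (WithLp.ofLp x))

/-- `Δ_R`, the difference of the supremum and the infimum of `R` over the simplex. -/
def regRange {A : Type*} [Fintype A] (R : (A → ℝ) → ℝ) : ℝ :=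
  sSup (R '' stdSimplex ℝ A) - sInf (R '' stdSimplex ℝ A)

/-- The constant `C_{Q^π}`. -/
def cQPi (ω I₂ ρ₁ ρ₂ : ℝ) : ℝ :=
  3 * ((ρ₁ + I₂ * ρ₂) / (1 - Real.exp (-(1 / ω))) ^ 2)
    + 2 * ((ρ₁ + ρ₂) / (1 - Real.exp (-(1 / ω))))

/-- The constant `C_Q`. -/
def cQ (ω I₂ ρ₁ ρ₂ : ℝ) : ℝ :=
  cQPi ω I₂ ρ₁ ρ₂ + (3 / (1 - Real.exp (-(1 / ω))) + 1) * ρ₁ + 2 * ρ₂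
    + (ρ₁ + I₂ * ρ₂) / (1 - Real.exp (-(1 / ω)))

end

/-!
Write `q = exp (-1/ω)`. For a fixed comparison policy `p`, the performance difference lemma
(`HasMixingTime.avgReward_sub_eq`) turns the regret of episode `t` into
`∑ s, d_t(s) ⟨Q_t(s), p(s) - π¹_t(s)⟩`, where `d_t` is the stationary distribution of `(p, π²_t)`.
So the regret is a weighted sum of regrets of online linear optimization problems, one in each
state, with weights that change by at most `I₂ ρ₂ / (1 - q)` per episode.

The analysis of the `Q`-values rests on the bias function `V` of a pair of policies, the solution
of the Poisson equation `V = r - η + P V` with `d ⬝ V = 0`. As `P` contracts differences of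
distributions, a bound for the inhomogeneity of such an equation bounds the oscillation of its
solution (`HasMixingTime.osc_le`). Applied to `V` this bounds the `Q`-values by `1 + 1 / (1 - q)`;
applied to the difference of two bias functions it shows that consecutive `Q`-values differ by at
most `C_Q` (`HasMixingTime.abs_qValue_sub_le`), so `Q_{t-1}` is a good prediction of `Q_t`.

Averaging the weights `w_{t,τ}` over `τ` amounts to averaging over windows of length `Γ`: the pairs
`(t, τ)` with fixed `t - τ` form one run of optimistic follow-the-regularized-leader that starts
afresh. Along such a run the potential `Φ(L) - ⟨L, p⟩` telescopes, where `Φ(L)` is the optimal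
regularized payoff against the cumulative payoff `L`, and every round costs at most
`ε / 2 * C_Q ^ 2` (`IsRegularizer.leaderValue_add_le`). There are `T + Γ - 1` runs, each of which
costs `Δ / ε`. Within a run the weights `d_t` are replaced by those at its start, which costs the
term with `I₂ ρ₂`. This is `windowed_regret_le`.

The first episode needs care, because `Q_0 = 0` does not predict `Q_1`. Its additional cost is
`⟨Q_1, w_{2,1} - π¹_1⟩`. All `w_{2,τ}` earn at least as much against `Q_1` as `w_{2,1}` does, hence
so does their mean `π¹_2`, and the cost is at most `‖Q_1‖ ρ₁ ≤ C_Q`. Since there are `T + Γ - 1`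
rather than `2 T` runs, and since `Δ ≥ 1 / 2` as soon as there are two actions, the claimed bound
leaves room for it (`learning_rate_bound`). A single episode has regret at most `1 ≤ 2 Δ`, and with
a single action there is no regret.
-/

open scoped Matrix

/-! ### Distributions and the `ℓ¹` norm -/

section l1

variable {ι κ : Type*} [Fintype ι] [Fintype κ]

theorem l1Norm_nonneg (v : ι → ℝ) : 0 ≤ l1Norm v :=
  Finset.sum_nonneg fun _ _ => abs_nonneg _

theorem l1Norm_add_le (v w : ι → ℝ) : l1Norm (v + w) ≤ l1Norm v + l1Norm w := by
  unfold l1Norm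
  rw [← Finset.sum_add_distrib]
  exact Finset.sum_le_sum fun i _ => abs_add_le _ _

theorem l1Norm_sub_le (v w : ι → ℝ) : l1Norm (v - w) ≤ l1Norm v + l1Norm w := by
  unfold l1Norm
  rw [← Finset.sum_add_distrib]
  exact Finset.sum_le_sum fun i _ => abs_sub _ _

theorem l1Norm_sub_le_sub_add_sub (u v w : ι → ℝ) :
    l1Norm (u - w) ≤ l1Norm (u - v) + l1Norm (v - w) := by
  simpa using l1Norm_add_le (u - v) (v - w)

theorem l1Norm_eq_one {x : ι → ℝ} (hx : x ∈ stdSimplex ℝ ι) : l1Norm x = 1 := by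
  rw [← hx.2]
  exact Finset.sum_congr rfl fun i _ => abs_of_nonneg (hx.1 i)

theorem l1Norm_sub_le_two {x y : ι → ℝ} (hx : x ∈ stdSimplex ℝ ι) (hy : y ∈ stdSimplex ℝ ι) :
    l1Norm (x - y) ≤ 2 := by
  have := l1Norm_sub_le x y
  rw [l1Norm_eq_one hx, l1Norm_eq_one hy] at this
  linarith

theorem abs_dotProduct_le {c : ℝ} (y v : ι → ℝ) (hv : ∀ i, |v i| ≤ c) :
    |y ⬝ᵥ v| ≤ l1Norm y * c := by
  unfold l1Norm dotProduct
  rw [Finset.sum_mul]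
  refine (Finset.abs_sum_le_sum_abs _ _).trans (Finset.sum_le_sum fun i _ => ?_)
  rw [abs_mul]
  exact mul_le_mul_of_nonneg_left (hv i) (abs_nonneg _)

theorem dotProduct_le_of_mem_stdSimplex {x v : ι → ℝ} {c : ℝ} (hx : x ∈ stdSimplex ℝ ι)
    (hv : ∀ i, v i ≤ c) : x ⬝ᵥ v ≤ c := by
  calc x ⬝ᵥ v ≤ ∑ i, x i * c := Finset.sum_le_sum fun i _ => mul_le_mul_of_nonneg_left (hv i) (hx.1 i)
    _ = c := by rw [← Finset.sum_mul, hx.2, one_mul]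

theorem le_dotProduct_of_mem_stdSimplex {x v : ι → ℝ} {c : ℝ} (hx : x ∈ stdSimplex ℝ ι)
    (hv : ∀ i, c ≤ v i) : c ≤ x ⬝ᵥ v := by
  calc c = ∑ i, x i * c := by rw [← Finset.sum_mul, hx.2, one_mul]
    _ ≤ x ⬝ᵥ v := Finset.sum_le_sum fun i _ => mul_le_mul_of_nonneg_left (hv i) (hx.1 i)

theorem dotProduct_const_of_mem_stdSimplex {x : ι → ℝ} (hx : x ∈ stdSimplex ℝ ι) (c : ℝ) :
    x ⬝ᵥ (fun _ => c) = c := by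
  unfold dotProduct
  rw [← Finset.sum_mul, hx.2, one_mul]

/-- The difference of two distributions sums to zero, so it only sees the oscillation of a
function, not its size. -/
theorem abs_sub_dotProduct_le_of_osc {x x' v : ι → ℝ} {B : ℝ} (hxx : ∑ i, x i = ∑ i, x' i)
    (hv : ∀ i j, v i - v j ≤ B) : |(x - x') ⬝ᵥ v| ≤ l1Norm (x - x') * (B / 2) := by
  rcases isEmpty_or_nonempty ι with h | h
  · simp [dotProduct, l1Norm]
  obtain ⟨i, hi⟩ := Finite.exists_max v
  obtain ⟨j, hj⟩ := Finite.exists_min v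
  have e : (x - x') ⬝ᵥ v = (x - x') ⬝ᵥ (v - fun _ => (v i + v j) / 2) := by
    rw [dotProduct_sub]
    have : (x - x') ⬝ᵥ (fun _ => (v i + v j) / 2) = 0 := by
      unfold dotProduct
      rw [← Finset.sum_mul]
      simp [hxx]
    rw [this, sub_zero]
  rw [e]
  refine abs_dotProduct_le _ _ fun l => ?_
  simp only [Pi.sub_apply, abs_le]
  constructor <;> linarith [hi l, hj l, hv i j]

theorem l1Norm_vecMul_le {K : ℝ} (c : ι → ℝ) (X : ι → κ → ℝ) (hX : ∀ i, l1Norm (X i) ≤ K) :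
    l1Norm (c ᵥ* Matrix.of X) ≤ l1Norm c * K := by
  calc l1Norm (c ᵥ* Matrix.of X) ≤ ∑ j, ∑ i, |c i| * |X i j| := by
        refine Finset.sum_le_sum fun j _ => (Finset.abs_sum_le_sum_abs _ _).trans_eq ?_
        simp [abs_mul]
    _ = ∑ i, |c i| * l1Norm (X i) := by
        rw [Finset.sum_comm]
        simp [l1Norm, Finset.mul_sum]
    _ ≤ ∑ i, |c i| * K :=
        Finset.sum_le_sum fun i _ => mul_le_mul_of_nonneg_left (hX i) (abs_nonneg _)
    _ = _ := by rw [← Finset.sum_mul, l1Norm]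

theorem vecMul_mem_stdSimplex {c : ι → ℝ} {X : ι → κ → ℝ} (hc : c ∈ stdSimplex ℝ ι)
    (hX : ∀ i, X i ∈ stdSimplex ℝ κ) : c ᵥ* Matrix.of X ∈ stdSimplex ℝ κ := by
  refine ⟨fun j => Finset.sum_nonneg fun i _ => mul_nonneg (hc.1 i) ((hX i).1 j), ?_⟩
  simp only [Matrix.vecMul, dotProduct, Matrix.of_apply]
  rw [Finset.sum_comm]
  simp only [← Finset.mul_sum, (hX _).2, mul_one, hc.2]

end l1

section rowNorm

variable {ι κ : Type*} [Fintype κ]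

theorem l1Norm_le_rowNorm [Finite ι] (B : ι → κ → ℝ) (i : ι) : l1Norm (B i) ≤ rowNorm B :=
  le_ciSup (f := fun i => l1Norm (B i)) (Set.finite_range _).bddAbove i

theorem rowNorm_nonneg (B : ι → κ → ℝ) : 0 ≤ rowNorm B :=
  Real.iSup_nonneg fun i => l1Norm_nonneg (B i)

theorem rowNorm_pos [Finite ι] {B : ι → κ → ℝ} (hB : B ≠ 0) : 0 < rowNorm B := by
  obtain ⟨i, hi⟩ := Function.ne_iff.1 hB
  obtain ⟨j, hj⟩ := Function.ne_iff.1 hi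
  refine lt_of_lt_of_le (abs_pos.2 hj) (le_trans ?_ (l1Norm_le_rowNorm B i))
  exact Finset.single_le_sum (f := fun j => |B i j|) (fun _ _ => abs_nonneg _) (Finset.mem_univ j)

theorem rowNorm_le {B : ι → κ → ℝ} {c : ℝ} (hc : 0 ≤ c) (h : ∀ i, l1Norm (B i) ≤ c) :
    rowNorm B ≤ c :=
  Real.iSup_le h hc

theorem policyChange_nonneg (T : ℕ) (p : ℕ → ι → κ → ℝ) : 0 ≤ policyChange T p := by
  refine Real.sSup_nonneg ?_
  rintro x ⟨t, -, -, rfl⟩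
  exact rowNorm_nonneg _

theorem rowNorm_sub_le_policyChange {T t : ℕ} (p : ℕ → ι → κ → ℝ) (ht : 1 ≤ t) (htT : t + 1 ≤ T) :
    rowNorm (p (t + 1) - p t) ≤ policyChange T p := by
  refine le_csSup ?_ ⟨t + 1, by omega, htT, by simp⟩
  refine Set.Finite.bddAbove (((Set.finite_Iic T).image
    fun t => rowNorm (p t - p (t - 1))).subset ?_)
  rintro x ⟨t, -, h, rfl⟩
  exact ⟨t, h, rfl⟩

end rowNorm

/-! ### Regularized leaders -/

section leader

variable {A : Type*} [Fintype A] {R : (A → ℝ) → ℝ}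

theorem IsRegularizer.apply_le (hR : IsRegularizer R) {x y : A → ℝ} (hx : x ∈ stdSimplex ℝ A)
    (hy : y ∈ stdSimplex ℝ A) {a b : ℝ} (ha : 0 ≤ a) (hb : 0 ≤ b) (hab : a + b = 1) :
    R (a • x + b • y) ≤ a * R x + b * R y - a * b * (1 / 2 * l1Norm (x - y) ^ 2) := by
  have h := hR.2 (x := WithLp.toLp 1 x) hx (y := WithLp.toLp 1 y) hy ha hb hab
  have e : ‖(WithLp.toLp 1 x : PiLp 1 (fun _ : A => ℝ)) - WithLp.toLp 1 y‖ = l1Norm (x - y) := by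
    rw [PiLp.norm_eq_of_L1]
    simp [l1Norm]
  rw [e] at h
  simpa using h

/-- A strongly convex function on the simplex is at most the largest of its values at the
vertices. -/
theorem IsRegularizer.bddAbove (hR : IsRegularizer R) : BddAbove (R '' stdSimplex ℝ A) := by
  classical
  have hc : ConvexOn ℝ (stdSimplex ℝ A) R := by
    refine ⟨convex_stdSimplex ℝ A, fun x hx y hy a b ha hb hab => ?_⟩
    have h := hR.apply_le hx hy ha hb hab
    have : 0 ≤ a * b * (1 / 2 * l1Norm (x - y) ^ 2) := by positivity
    simp only [smul_eq_mul]
    linarith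
  refine ⟨∑ i, |R (Pi.single i 1)|, ?_⟩
  rintro _ ⟨x, hx, rfl⟩
  have h := hc.map_sum_le (t := Finset.univ) (w := x) (p := fun i => Pi.single i (1 : ℝ))
    (fun i _ => hx.1 i) hx.2 (fun i _ => single_mem_stdSimplex ℝ i)
  have e : ∑ i, x i • (Pi.single i (1 : ℝ) : A → ℝ) = x := by
    ext j
    simp [Finset.sum_apply, Pi.single_apply]
  rw [e] at h
  refine h.trans (Finset.sum_le_sum fun i _ => ?_)
  have hx1 : x i ≤ 1 := hx.2 ▸ Finset.single_le_sum (fun j _ => hx.1 j) (Finset.mem_univ i)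
  calc x i • R (Pi.single i 1) ≤ x i * |R (Pi.single i 1)| :=
        mul_le_mul_of_nonneg_left (le_abs_self _) (hx.1 i)
    _ ≤ _ := mul_le_of_le_one_left (abs_nonneg _) hx1

/-- With two actions at least, the regularizer drops by `1 / 2` from the average of two vertices
to their midpoint. -/
theorem IsRegularizer.half_le_regRange [Nontrivial A] (hR : IsRegularizer R)
    (hb : BddBelow (R '' stdSimplex ℝ A)) : 1 / 2 ≤ regRange R := by
  classical
  obtain ⟨a, b, hab⟩ := exists_pair_ne A
  have ha := single_mem_stdSimplex ℝ a
  have hb' := single_mem_stdSimplex ℝ b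
  have h := hR.apply_le ha hb' (a := 1 / 2) (b := 1 / 2) (by norm_num) (by norm_num) (by norm_num)
  have e : l1Norm (Pi.single a (1 : ℝ) - Pi.single b (1 : ℝ) : A → ℝ) = 2 := by
    unfold l1Norm
    rw [← Finset.add_sum_erase _ _ (Finset.mem_univ a),
      ← Finset.add_sum_erase _ _ (Finset.mem_erase.2 ⟨hab.symm, Finset.mem_univ b⟩),
      Finset.sum_eq_zero]
    · simp [hab, hab.symm]
      norm_num
    · intro i hi
      simp only [Finset.mem_erase] at hi
      simp [hi.1, hi.2.1]
  have hm : (1 / 2 : ℝ) • Pi.single a (1 : ℝ) + (1 / 2 : ℝ) • Pi.single b (1 : ℝ)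
      ∈ stdSimplex ℝ A :=
    convex_stdSimplex ℝ A ha hb' (by norm_num) (by norm_num) (by norm_num)
  have h1 := le_csSup hR.bddAbove ⟨_, ha, rfl⟩
  have h2 := le_csSup hR.bddAbove ⟨_, hb', rfl⟩
  have h3 := csInf_le hb ⟨_, hm, rfl⟩
  rw [e] at h
  unfold regRange
  linarith

theorem regRange_nonneg [Nonempty A] (hR : IsRegularizer R)
    (hb : BddBelow (R '' stdSimplex ℝ A)) : 0 ≤ regRange R := by
  classical
  obtain ⟨a⟩ := ‹Nonempty A›
  have ha := single_mem_stdSimplex ℝ a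
  have h1 := le_csSup hR.bddAbove ⟨_, ha, rfl⟩
  have h3 := csInf_le hb ⟨_, ha, rfl⟩
  unfold regRange
  linarith

/-- The regularized payoff of the weights `v` against the cumulative payoffs `L`. -/
noncomputable def leaderObj (R : (A → ℝ) → ℝ) (ε : ℝ) (L v : A → ℝ) : ℝ := L ⬝ᵥ v - R v / ε

/-- The optimal regularized payoff against `L`. It is a supremum, as a regularizer that is not
lower semicontinuous need not have a maximizer for every `L`. -/
noncomputable def leaderValue (R : (A → ℝ) → ℝ) (ε : ℝ) (L : A → ℝ) : ℝ :=
  sSup (leaderObj R ε L '' stdSimplex ℝ A)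

theorem leaderObj_le_leaderValue (hb : BddBelow (R '' stdSimplex ℝ A)) {ε : ℝ} (hε : 0 < ε)
    (L : A → ℝ) {v : A → ℝ} (hv : v ∈ stdSimplex ℝ A) :
    leaderObj R ε L v ≤ leaderValue R ε L := by
  refine le_csSup ?_ ⟨v, hv, rfl⟩
  obtain ⟨c, hc⟩ := hb
  refine ⟨(∑ i, |L i|) - c / ε, ?_⟩
  rintro _ ⟨x, hx, rfl⟩
  have h1 : c / ε ≤ R x / ε := div_le_div_of_nonneg_right (hc ⟨x, hx, rfl⟩) hε.le
  have h2 : L ⬝ᵥ x ≤ ∑ i, |L i| := by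
    rw [dotProduct_comm]
    exact dotProduct_le_of_mem_stdSimplex hx fun i => (le_abs_self _).trans
      (Finset.single_le_sum (f := fun i => |L i|) (fun _ _ => abs_nonneg _) (Finset.mem_univ i))
  unfold leaderObj
  linarith

theorem leaderValue_le [Nonempty A] {ε c : ℝ} {L : A → ℝ}
    (h : ∀ v ∈ stdSimplex ℝ A, leaderObj R ε L v ≤ c) : leaderValue R ε L ≤ c := by
  classical
  obtain ⟨a⟩ := ‹Nonempty A›
  refine csSup_le ⟨_, _, single_mem_stdSimplex ℝ a, rfl⟩ ?_
  rintro _ ⟨v, hv, rfl⟩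
  exact h v hv

theorem leaderValue_zero_le [Nonempty A] (hb : BddBelow (R '' stdSimplex ℝ A)) {ε : ℝ}
    (hε : 0 < ε) : leaderValue R ε 0 ≤ -(sInf (R '' stdSimplex ℝ A) / ε) := by
  refine leaderValue_le fun v hv => ?_
  have := div_le_div_of_nonneg_right (csInf_le hb ⟨v, hv, rfl⟩) hε.le
  simp only [leaderObj, zero_dotProduct]
  linarith

theorem le_leaderValue_sub (hR : IsRegularizer R) (hb : BddBelow (R '' stdSimplex ℝ A)) {ε : ℝ}
    (hε : 0 < ε) (L : A → ℝ) {v : A → ℝ} (hv : v ∈ stdSimplex ℝ A) :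
    -(sSup (R '' stdSimplex ℝ A) / ε) ≤ leaderValue R ε L - L ⬝ᵥ v := by
  have h1 := leaderObj_le_leaderValue hb hε L hv
  have h2 := div_le_div_of_nonneg_right (le_csSup hR.bddAbove ⟨v, hv, rfl⟩) hε.le
  unfold leaderObj at h1
  linarith

/-- Around a maximizer the regularized payoff decreases quadratically. -/
theorem IsRegularizer.leaderObj_le_sub (hR : IsRegularizer R) {ε : ℝ} (hε : 0 < ε) {L w v : A → ℝ}
    (hw : w ∈ stdSimplex ℝ A) (hmax : IsMaxOn (leaderObj R ε L) (stdSimplex ℝ A) w)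
    (hv : v ∈ stdSimplex ℝ A) :
    leaderObj R ε L v ≤ leaderObj R ε L w - l1Norm (v - w) ^ 2 / (2 * ε) := by
  set N := l1Norm (v - w) ^ 2 / (2 * ε) with hN
  have key : ∀ b : ℝ, 0 < b → b < 1 →
      leaderObj R ε L v ≤ leaderObj R ε L w - (1 - b) * N := by
    intro b hb0 hb1
    have hmem : b • v + (1 - b) • w ∈ stdSimplex ℝ A :=
      convex_stdSimplex ℝ A hv hw hb0.le (by linarith) (by ring)
    have h1 : leaderObj R ε L (b • v + (1 - b) • w) ≤ leaderObj R ε L w := hmax hmem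
    have h2 := div_le_div_of_nonneg_right
      (hR.apply_le hv hw hb0.le (b := 1 - b) (by linarith) (by ring)) hε.le
    have h3 : (b * R v + (1 - b) * R w - b * (1 - b) * (1 / 2 * l1Norm (v - w) ^ 2)) / ε
        = b * (R v / ε) + (1 - b) * (R w / ε) - b * (1 - b) * N := by
      rw [hN]; field_simp
    rw [h3] at h2
    unfold leaderObj at h1 ⊢
    rw [dotProduct_add, dotProduct_smul, dotProduct_smul, smul_eq_mul, smul_eq_mul] at h1
    have h4 : b * (L ⬝ᵥ v - R v / ε) ≤ b * (L ⬝ᵥ w - R w / ε - (1 - b) * N) := by linarith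
    exact le_of_mul_le_mul_left h4 hb0
  have hlim : Filter.Tendsto (fun b : ℝ => leaderObj R ε L w - (1 - b) * N)
      (nhdsWithin 0 (Set.Ioi 0)) (nhds (leaderObj R ε L w - (1 - 0) * N)) :=
    (Continuous.tendsto (by fun_prop) 0).mono_left nhdsWithin_le_nhds
  have h := ge_of_tendsto hlim (by
    filter_upwards [Ioo_mem_nhdsGT (zero_lt_one' ℝ)] with b hb using key b hb.1 hb.2)
  linarith

/-- One round of optimistic follow-the-regularized-leader: if `w` is the leader for the history
`L` and the prediction `m`, and the payoff turns out to be `u`, then the growth of the optimal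
value exceeds the payoff of `w` only by the squared error of the prediction. -/
theorem IsRegularizer.leaderValue_add_le [Nonempty A] (hR : IsRegularizer R)
    (hb : BddBelow (R '' stdSimplex ℝ A)) {ε : ℝ} (hε : 0 < ε) {L m u w : A → ℝ} {δ : ℝ}
    (hw : w ∈ stdSimplex ℝ A)
    (hmax : IsMaxOn (leaderObj R ε (L + m)) (stdSimplex ℝ A) w) (hδ : ∀ a, |u a - m a| ≤ δ) :
    leaderValue R ε (L + u) ≤ leaderValue R ε L + u ⬝ᵥ w + ε / 2 * δ ^ 2 := by
  refine leaderValue_le fun v hv => ?_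
  have h1 := hR.leaderObj_le_sub hε hw hmax hv
  have h2 := leaderObj_le_leaderValue hb hε L hw
  have h3 : (u - m) ⬝ᵥ (v - w) ≤ l1Norm (v - w) * δ := by
    rw [dotProduct_comm]
    exact (le_abs_self _).trans (abs_dotProduct_le _ _ hδ)
  have h4 : l1Norm (v - w) * δ ≤ ε / 2 * δ ^ 2 + l1Norm (v - w) ^ 2 / (2 * ε) := by
    have : ε / 2 * δ ^ 2 + l1Norm (v - w) ^ 2 / (2 * ε) - l1Norm (v - w) * δ
        = (ε * δ - l1Norm (v - w)) ^ 2 / (2 * ε) := by field_simp; ring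
    have : 0 ≤ (ε * δ - l1Norm (v - w)) ^ 2 / (2 * ε) := by positivity
    linarith
  unfold leaderObj at *
  simp only [add_dotProduct, sub_dotProduct, dotProduct_sub] at *
  linarith

/-- A leader against a scaled up payoff `L + L` earns at least what the leader against `L` does. -/
theorem dotProduct_leader_mono {ε : ℝ} {L g w : A → ℝ} (hg : g ∈ stdSimplex ℝ A)
    (hw : w ∈ stdSimplex ℝ A) (hgmax : IsMaxOn (leaderObj R ε L) (stdSimplex ℝ A) g)
    (hwmax : IsMaxOn (leaderObj R ε (L + L)) (stdSimplex ℝ A) w) : L ⬝ᵥ g ≤ L ⬝ᵥ w := by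
  have h1 : leaderObj R ε L w ≤ leaderObj R ε L g := hgmax hw
  have h2 : leaderObj R ε (L + L) g ≤ leaderObj R ε (L + L) w := hwmax hg
  unfold leaderObj at h1 h2
  simp only [add_dotProduct] at h2
  linarith

end leader

/-! ### Averages over policies and the influence of the second agent -/

namespace TwoAgentMDP

section influence

variable {S A₁ A₂ : Type*} [Fintype S] [Fintype A₂] (M : TwoAgentMDP S A₁ A₂)
  {p₁ p₁' : S → A₁ → ℝ} {p₂ p₂' : S → A₂ → ℝ}

theorem nextDist_mem (h₂ : IsPolicy p₂) (s : S) (a : A₁) : M.nextDist p₂ s a ∈ stdSimplex ℝ S :=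
  vecMul_mem_stdSimplex (h₂ s) (M.P_mem s a)

theorem nextDist_eq_vecMul (p₂ : S → A₂ → ℝ) (s : S) (a : A₁) :
    M.nextDist p₂ s a = p₂ s ᵥ* Matrix.of (M.P s a) := rfl

theorem expReward_mem (h₂ : IsPolicy p₂) (s : S) (a : A₁) :
    M.expReward p₂ s a ∈ Set.Icc (0 : ℝ) 1 :=
  ⟨le_dotProduct_of_mem_stdSimplex (h₂ s) fun b => (M.r_mem s a b).1,
    dotProduct_le_of_mem_stdSimplex (h₂ s) fun b => (M.r_mem s a b).2⟩

theorem abs_expReward_sub_le (p₂ p₂' : S → A₂ → ℝ) (s : S) (a : A₁) :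
    |M.expReward p₂ s a - M.expReward p₂' s a| ≤ rowNorm (p₂ - p₂') := by
  have e : M.expReward p₂ s a - M.expReward p₂' s a = (p₂ s - p₂' s) ⬝ᵥ M.r s a :=
    (sub_dotProduct _ _ _).symm
  rw [e]
  refine (abs_dotProduct_le (c := 1) _ _ fun b => ?_).trans ?_
  · rw [abs_of_nonneg (M.r_mem s a b).1]
    exact (M.r_mem s a b).2
  · rw [mul_one]
    exact l1Norm_le_rowNorm (p₂ - p₂') s

theorem l1Norm_nextDist_sub_le_rowNorm (p₂ p₂' : S → A₂ → ℝ) (s : S) (a : A₁) :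
    l1Norm (M.nextDist p₂ s a - M.nextDist p₂' s a) ≤ rowNorm (p₂ - p₂') := by
  rw [nextDist_eq_vecMul, nextDist_eq_vecMul, ← Matrix.sub_vecMul]
  refine (l1Norm_vecMul_le (K := 1) _ _ fun b => (l1Norm_eq_one (M.P_mem s a b)).le).trans ?_
  rw [mul_one]
  exact l1Norm_le_rowNorm (p₂ - p₂') s

variable [Fintype A₁]

theorem transMat_mem (h₁ : IsPolicy p₁) (h₂ : IsPolicy p₂) (s : S) :
    M.transMat p₁ p₂ s ∈ stdSimplex ℝ S :=
  vecMul_mem_stdSimplex (h₁ s) (M.nextDist_mem h₂ s)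

theorem transMat_eq_vecMul (p₁ : S → A₁ → ℝ) (p₂ : S → A₂ → ℝ) (s : S) :
    M.transMat p₁ p₂ s = p₁ s ᵥ* Matrix.of (M.nextDist p₂ s) := rfl

theorem policyReward_mem (h₁ : IsPolicy p₁) (h₂ : IsPolicy p₂) (s : S) :
    M.policyReward p₁ p₂ s ∈ Set.Icc (0 : ℝ) 1 :=
  ⟨le_dotProduct_of_mem_stdSimplex (h₁ s) fun a => (M.expReward_mem h₂ s a).1,
    dotProduct_le_of_mem_stdSimplex (h₁ s) fun a => (M.expReward_mem h₂ s a).2⟩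

theorem abs_policyReward_sub_le (h₁' : IsPolicy p₁') (h₂ : IsPolicy p₂) (s : S) :
    |M.policyReward p₁ p₂ s - M.policyReward p₁' p₂' s|
      ≤ rowNorm (p₁ - p₁') + rowNorm (p₂ - p₂') := by
  have e : M.policyReward p₁ p₂ s - M.policyReward p₁' p₂' s
      = (p₁ s - p₁' s) ⬝ᵥ M.expReward p₂ s
        + p₁' s ⬝ᵥ (M.expReward p₂ s - M.expReward p₂' s) := by
    rw [sub_dotProduct, dotProduct_sub]
    simp only [policyReward, dotProduct]
    ring
  rw [e]
  refine (abs_add_le _ _).trans (add_le_add ?_ ?_)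
  · refine (abs_dotProduct_le (c := 1) _ _ fun a => ?_).trans ?_
    · rw [abs_of_nonneg (M.expReward_mem h₂ s a).1]
      exact (M.expReward_mem h₂ s a).2
    · rw [mul_one]
      exact l1Norm_le_rowNorm (p₁ - p₁') s
  · refine (abs_dotProduct_le _ _ fun a => M.abs_expReward_sub_le p₂ p₂' s a).trans ?_
    rw [l1Norm_eq_one (h₁' s), one_mul]

theorem rowNorm_transMat_sub_le_rowNorm (h₁ : IsPolicy p₁) :
    rowNorm (M.transMat p₁ p₂ - M.transMat p₁ p₂') ≤ rowNorm (p₂ - p₂') := by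
  refine rowNorm_le (rowNorm_nonneg _) fun s => ?_
  have e : (M.transMat p₁ p₂ - M.transMat p₁ p₂') s
      = p₁ s ᵥ* (Matrix.of (M.nextDist p₂ s) - Matrix.of (M.nextDist p₂' s)) := by
    rw [Matrix.vecMul_sub]; rfl
  rw [e]
  have h := l1Norm_vecMul_le (p₁ s) (M.nextDist p₂ s - M.nextDist p₂' s)
    fun a => M.l1Norm_nextDist_sub_le_rowNorm p₂ p₂' s a
  rw [l1Norm_eq_one (h₁ s), one_mul] at h
  exact h

theorem influence₂_nonneg : 0 ≤ M.influence₂ := by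
  refine Real.sSup_nonneg ?_
  rintro x ⟨p₁, p₂, p₂', -, -, -, -, rfl⟩
  exact div_nonneg (rowNorm_nonneg _) (rowNorm_nonneg _)

theorem rowNorm_transMat_sub_le (h₁ : IsPolicy p₁) (h₂ : IsPolicy p₂) (h₂' : IsPolicy p₂') :
    rowNorm (M.transMat p₁ p₂ - M.transMat p₁ p₂') ≤ M.influence₂ * rowNorm (p₂ - p₂') := by
  rcases eq_or_ne p₂ p₂' with rfl | hne
  · have : rowNorm (M.transMat p₁ p₂ - M.transMat p₁ p₂) ≤ 0 :=
      rowNorm_le le_rfl fun s => by simp [l1Norm]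
    exact this.trans (mul_nonneg M.influence₂_nonneg (rowNorm_nonneg _))
  · have hpos : 0 < rowNorm (p₂ - p₂') := rowNorm_pos (sub_ne_zero.2 hne)
    rw [← div_le_iff₀ hpos]
    refine le_csSup ⟨1, ?_⟩ ⟨p₁, p₂, p₂', h₁, h₂, h₂', hne, rfl⟩
    rintro x ⟨q₁, q₂, q₂', g₁, -, -, hq, rfl⟩
    exact (div_le_one (rowNorm_pos (sub_ne_zero.2 hq))).2 (M.rowNorm_transMat_sub_le_rowNorm g₁)

/-- A fixed action of the first agent is a policy, so the influence also bounds the change of the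
distribution of the next state after that action. -/
theorem l1Norm_nextDist_sub_le (h₂ : IsPolicy p₂) (h₂' : IsPolicy p₂') (s : S) (a : A₁) :
    l1Norm (M.nextDist p₂ s a - M.nextDist p₂' s a) ≤ M.influence₂ * rowNorm (p₂ - p₂') := by
  classical
  have hp : IsPolicy (fun _ : S => (Pi.single a 1 : A₁ → ℝ)) :=
    fun _ => single_mem_stdSimplex ℝ a
  have h : l1Norm (M.transMat (fun _ : S => (Pi.single a 1 : A₁ → ℝ)) p₂ s
      - M.transMat (fun _ : S => (Pi.single a 1 : A₁ → ℝ)) p₂' s) ≤ _ :=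
    (l1Norm_le_rowNorm _ s).trans (M.rowNorm_transMat_sub_le hp h₂ h₂')
  have e : ∀ q : S → A₂ → ℝ, M.transMat (fun _ : S => (Pi.single a 1 : A₁ → ℝ)) q s
      = M.nextDist q s a := by
    intro q
    rw [transMat_eq_vecMul, Matrix.single_one_vecMul]
    rfl
  rwa [e, e] at h

theorem l1Norm_transMat_sub_le (h₁ : IsPolicy p₁) (h₂ : IsPolicy p₂) (h₂' : IsPolicy p₂') (s : S) :
    l1Norm (M.transMat p₁ p₂ s - M.transMat p₁' p₂' s)
      ≤ rowNorm (p₁ - p₁') + M.influence₂ * rowNorm (p₂ - p₂') := by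
  refine (l1Norm_sub_le_sub_add_sub _ (M.transMat p₁ p₂' s) _).trans ?_
  rw [add_comm]
  refine add_le_add ?_ ?_
  · rw [transMat_eq_vecMul, transMat_eq_vecMul, ← Matrix.sub_vecMul]
    refine (l1Norm_vecMul_le (K := 1) _ _
      fun a => (l1Norm_eq_one (M.nextDist_mem h₂' s a)).le).trans ?_
    rw [mul_one]
    exact l1Norm_le_rowNorm (p₁ - p₁') s
  · exact (l1Norm_le_rowNorm (M.transMat p₁ p₂ - M.transMat p₁ p₂') s).trans
      (M.rowNorm_transMat_sub_le h₁ h₂ h₂')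

theorem HasMixingTime.one_sub_pos {M : TwoAgentMDP S A₁ A₂} {ω : ℝ} (hM : M.HasMixingTime ω) :
    0 < 1 - Real.exp (-(1 / ω)) := by
  have : Real.exp (-(1 / ω)) < 1 := by
    rw [Real.exp_lt_one_iff]
    have := one_div_pos.mpr hM.1
    linarith
  linarith

end influence

/-! ### The bias function of a pair of policies -/

section bias

variable {S A₁ A₂ : Type*} [Fintype S] [Fintype A₁] [Fintype A₂] [DecidableEq S]
  {M : TwoAgentMDP S A₁ A₂} {ω : ℝ} {p p₁ p₁' : S → A₁ → ℝ} {p₂ p₂' : S → A₂ → ℝ}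

/-- The bias (relative value) of the states: the total expected excess of the rewards over the
average reward. -/
noncomputable def bias (M : TwoAgentMDP S A₁ A₂) (p₁ : S → A₁ → ℝ) (p₂ : S → A₂ → ℝ) (s : S) : ℝ :=
  ∑' m : ℕ, (((M.transMat p₁ p₂) ^ m *ᵥ M.policyReward p₁ p₂) s - M.avgReward p₁ p₂)

theorem vecMul_transMat_pow_mem (h₁ : IsPolicy p₁) (h₂ : IsPolicy p₂) {x : S → ℝ}
    (hx : x ∈ stdSimplex ℝ S) (n : ℕ) : x ᵥ* M.transMat p₁ p₂ ^ n ∈ stdSimplex ℝ S := by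
  induction n with
  | zero => simpa using hx
  | succ n ih =>
    rw [pow_succ, ← Matrix.vecMul_vecMul]
    exact vecMul_mem_stdSimplex ih (M.transMat_mem h₁ h₂)

theorem HasMixingTime.l1Norm_vecMul_pow_sub_le (hM : M.HasMixingTime ω) (h₁ : IsPolicy p₁)
    (h₂ : IsPolicy p₂) {x y : S → ℝ} (hx : x ∈ stdSimplex ℝ S) (hy : y ∈ stdSimplex ℝ S) (n : ℕ) :
    l1Norm (x ᵥ* M.transMat p₁ p₂ ^ n - y ᵥ* M.transMat p₁ p₂ ^ n)
      ≤ l1Norm (x - y) * Real.exp (-(1 / ω)) ^ n := by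
  induction n with
  | zero => simp
  | succ n ih =>
    rw [pow_succ, ← Matrix.vecMul_vecMul, ← Matrix.vecMul_vecMul]
    refine (hM.2 p₁ p₂ h₁ h₂ _ (vecMul_transMat_pow_mem h₁ h₂ hx n) _
      (vecMul_transMat_pow_mem h₁ h₂ hy n)).trans ?_
    refine (mul_le_mul_of_nonneg_left ih (Real.exp_pos _).le).trans_eq ?_
    ring

variable [Nonempty S]

theorem HasMixingTime.statDist_vecMul_pow (hM : M.HasMixingTime ω) (h₁ : IsPolicy p₁)
    (h₂ : IsPolicy p₂) (n : ℕ) :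
    M.statDist p₁ p₂ ᵥ* M.transMat p₁ p₂ ^ n = M.statDist p₁ p₂ := by
  induction n with
  | zero => simp
  | succ n ih =>
    rw [pow_succ, ← Matrix.vecMul_vecMul, ih, (M.isStationary_statDist hM h₁ h₂).2.1]

theorem HasMixingTime.statDist_mem (hM : M.HasMixingTime ω) (h₁ : IsPolicy p₁)
    (h₂ : IsPolicy p₂) : M.statDist p₁ p₂ ∈ stdSimplex ℝ S :=
  (M.isStationary_statDist hM h₁ h₂).1

theorem HasMixingTime.avgReward_mem (hM : M.HasMixingTime ω) (h₁ : IsPolicy p₁)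
    (h₂ : IsPolicy p₂) : M.avgReward p₁ p₂ ∈ Set.Icc (0 : ℝ) 1 :=
  ⟨le_dotProduct_of_mem_stdSimplex (hM.statDist_mem h₁ h₂) fun s => (M.policyReward_mem h₁ h₂ s).1,
    dotProduct_le_of_mem_stdSimplex (hM.statDist_mem h₁ h₂) fun s => (M.policyReward_mem h₁ h₂ s).2⟩

/-- Started in `x`, the expected rewards converge geometrically to the average reward. -/
theorem HasMixingTime.summable_reward_sub (hM : M.HasMixingTime ω) (h₁ : IsPolicy p₁)
    (h₂ : IsPolicy p₂) {x : S → ℝ} (hx : x ∈ stdSimplex ℝ S) :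
    Summable fun m : ℕ =>
      (x ᵥ* M.transMat p₁ p₂ ^ m) ⬝ᵥ M.policyReward p₁ p₂ - M.avgReward p₁ p₂ := by
  have hq1 : Real.exp (-(1 / ω)) < 1 := by linarith [hM.one_sub_pos]
  refine Summable.of_norm_bounded (g := fun m : ℕ =>
    l1Norm (x - M.statDist p₁ p₂) * Real.exp (-(1 / ω)) ^ m)
    ((summable_geometric_of_lt_one (Real.exp_pos _).le hq1).mul_left _) fun m => ?_
  have e : (x ᵥ* M.transMat p₁ p₂ ^ m) ⬝ᵥ M.policyReward p₁ p₂ - M.avgReward p₁ p₂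
      = (x ᵥ* M.transMat p₁ p₂ ^ m - M.statDist p₁ p₂ ᵥ* M.transMat p₁ p₂ ^ m)
          ⬝ᵥ M.policyReward p₁ p₂ := by
    rw [sub_dotProduct, hM.statDist_vecMul_pow h₁ h₂]
    rfl
  rw [e, Real.norm_eq_abs]
  refine (abs_dotProduct_le (c := 1) _ _ fun s => ?_).trans ?_
  · rw [abs_of_nonneg (M.policyReward_mem h₁ h₂ s).1]
    exact (M.policyReward_mem h₁ h₂ s).2
  · rw [mul_one]
    exact hM.l1Norm_vecMul_pow_sub_le h₁ h₂ hx (hM.statDist_mem h₁ h₂) m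

theorem HasMixingTime.hasSum_dotProduct_bias (hM : M.HasMixingTime ω) (h₁ : IsPolicy p₁)
    (h₂ : IsPolicy p₂) {x : S → ℝ} (hx : x ∈ stdSimplex ℝ S) :
    HasSum (fun m : ℕ =>
      (x ᵥ* M.transMat p₁ p₂ ^ m) ⬝ᵥ M.policyReward p₁ p₂ - M.avgReward p₁ p₂)
      (x ⬝ᵥ M.bias p₁ p₂) := by
  have hs : ∀ s, HasSum (fun m : ℕ =>
      ((M.transMat p₁ p₂) ^ m *ᵥ M.policyReward p₁ p₂) s - M.avgReward p₁ p₂)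
      (M.bias p₁ p₂ s) := by
    intro s
    refine Summable.hasSum ?_
    refine (hM.summable_reward_sub h₁ h₂ (single_mem_stdSimplex ℝ s)).congr fun m => ?_
    rw [← Matrix.dotProduct_mulVec, single_one_dotProduct]
  refine (hasSum_sum fun s _ => (hs s).mul_left (x s)).congr_fun fun m => ?_
  rw [← Matrix.dotProduct_mulVec]
  simp only [mul_sub, Finset.sum_sub_distrib, ← Finset.sum_mul, hx.2, one_mul]
  rfl

/-- The Poisson equation. -/
theorem HasMixingTime.bias_eq (hM : M.HasMixingTime ω) (h₁ : IsPolicy p₁) (h₂ : IsPolicy p₂)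
    (s : S) : M.bias p₁ p₂ s
      = M.policyReward p₁ p₂ s - M.avgReward p₁ p₂ + M.transMat p₁ p₂ s ⬝ᵥ M.bias p₁ p₂ := by
  have h := hM.hasSum_dotProduct_bias h₁ h₂ (single_mem_stdSimplex ℝ s)
  have h' := hM.hasSum_dotProduct_bias h₁ h₂ (M.transMat_mem h₁ h₂ s)
  rw [single_one_dotProduct] at h
  rw [← hasSum_nat_add_iff' 1] at h
  have e := h.unique (h'.congr_fun fun m => by
    rw [pow_succ', ← Matrix.vecMul_vecMul, Matrix.single_one_vecMul]; rfl)
  simp only [Finset.range_one, Finset.sum_singleton, pow_zero, Matrix.vecMul_one,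
    single_one_dotProduct] at e
  linarith

theorem HasMixingTime.statDist_dotProduct_bias (hM : M.HasMixingTime ω) (h₁ : IsPolicy p₁)
    (h₂ : IsPolicy p₂) : M.statDist p₁ p₂ ⬝ᵥ M.bias p₁ p₂ = 0 := by
  refine (hM.hasSum_dotProduct_bias h₁ h₂ (hM.statDist_mem h₁ h₂)).unique ?_
  refine hasSum_zero.congr_fun fun m => ?_
  rw [hM.statDist_vecMul_pow h₁ h₂]
  exact sub_self _

theorem HasMixingTime.qValue_eq (hM : M.HasMixingTime ω) (h₁ : IsPolicy p₁) (h₂ : IsPolicy p₂)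
    (s : S) (a : A₁) : M.qValue p₁ p₂ s a
      = M.expReward p₂ s a - M.avgReward p₁ p₂ + M.nextDist p₂ s a ⬝ᵥ M.bias p₁ p₂ := by
  have h := hM.hasSum_dotProduct_bias h₁ h₂ (M.nextDist_mem h₂ s a)
  have h' := (hasSum_nat_add_iff
    (f := fun m => M.roundReward p₁ p₂ s a m - M.avgReward p₁ p₂) 1).1 h
  rw [qValue, h'.tsum_eq, Finset.sum_range_one, add_comm]
  rfl

/-- The contraction of one step of the chain turns a bound `c` for the inhomogeneity of a
Poisson equation into a bound for the oscillation of its solution. -/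
theorem HasMixingTime.osc_le (hM : M.HasMixingTime ω) (h₁ : IsPolicy p₁) (h₂ : IsPolicy p₂)
    {V f : S → ℝ} {c : ℝ} (hV : ∀ s, V s = f s + M.transMat p₁ p₂ s ⬝ᵥ V)
    (hf : ∀ s s', f s - f s' ≤ c) (s s' : S) :
    V s - V s' ≤ c / (1 - Real.exp (-(1 / ω))) := by
  obtain ⟨i, hi⟩ := Finite.exists_max V
  obtain ⟨j, hj⟩ := Finite.exists_min V
  have hB : ∀ s s', V s - V s' ≤ V i - V j := fun s s' => by linarith [hi s, hj s']
  refine (hB s s').trans ?_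
  rw [le_div_iff₀ hM.one_sub_pos]
  have hrow : ∀ s, M.transMat p₁ p₂ s = Pi.single s (1 : ℝ) ᵥ* M.transMat p₁ p₂ := by
    intro s
    rw [Matrix.single_one_vecMul]
    rfl
  have h2 : l1Norm (M.transMat p₁ p₂ i - M.transMat p₁ p₂ j) ≤ Real.exp (-(1 / ω)) * 2 := by
    rw [hrow i, hrow j]
    refine (hM.2 p₁ p₂ h₁ h₂ _ (single_mem_stdSimplex ℝ i) _ (single_mem_stdSimplex ℝ j)).trans ?_
    exact mul_le_mul_of_nonneg_left
      (l1Norm_sub_le_two (single_mem_stdSimplex ℝ i) (single_mem_stdSimplex ℝ j)) (Real.exp_pos _).le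
  have h3 := abs_sub_dotProduct_le_of_osc (x := M.transMat p₁ p₂ i) (x' := M.transMat p₁ p₂ j)
    (by rw [(M.transMat_mem h₁ h₂ i).2, (M.transMat_mem h₁ h₂ j).2]) hB
  have h4 := mul_le_mul_of_nonneg_right h2
    (show 0 ≤ (V i - V j) / 2 by linarith [hi j])
  rw [sub_dotProduct] at h3
  have h5 := le_abs_self (M.transMat p₁ p₂ i ⬝ᵥ V - M.transMat p₁ p₂ j ⬝ᵥ V)
  have h6 := hV i
  have h7 := hV j
  have h8 := hf i j
  linarith

theorem HasMixingTime.bias_sub_le (hM : M.HasMixingTime ω) (h₁ : IsPolicy p₁) (h₂ : IsPolicy p₂)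
    (s s' : S) : M.bias p₁ p₂ s - M.bias p₁ p₂ s' ≤ 1 / (1 - Real.exp (-(1 / ω))) := by
  refine hM.osc_le h₁ h₂ (hM.bias_eq h₁ h₂) (fun s s' => ?_) s s'
  linarith [(M.policyReward_mem h₁ h₂ s).2, (M.policyReward_mem h₁ h₂ s').1]

theorem HasMixingTime.abs_qValue_le (hM : M.HasMixingTime ω) (h₁ : IsPolicy p₁)
    (h₂ : IsPolicy p₂) (s : S) (a : A₁) :
    |M.qValue p₁ p₂ s a| ≤ 1 + 1 / (1 - Real.exp (-(1 / ω))) := by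
  have hx := M.nextDist_mem (a := a) h₂ s
  have hd := hM.statDist_mem h₁ h₂
  have e : M.qValue p₁ p₂ s a = (M.expReward p₂ s a - M.avgReward p₁ p₂)
      + (M.nextDist p₂ s a - M.statDist p₁ p₂) ⬝ᵥ M.bias p₁ p₂ := by
    rw [hM.qValue_eq h₁ h₂, sub_dotProduct, hM.statDist_dotProduct_bias h₁ h₂, sub_zero]
  rw [e]
  refine (abs_add_le _ _).trans (add_le_add ?_ ?_)
  · have hr := M.expReward_mem h₂ s a
    have hη := hM.avgReward_mem h₁ h₂
    exact abs_le.2 ⟨by linarith [hr.1, hη.2], by linarith [hr.2, hη.1]⟩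
  · have h := abs_sub_dotProduct_le_of_osc (hx.2.trans hd.2.symm) (hM.bias_sub_le h₁ h₂)
    have h2 := mul_le_mul_of_nonneg_right (l1Norm_sub_le_two hx hd)
      (show 0 ≤ 1 / (1 - Real.exp (-(1 / ω))) / 2 from
        div_nonneg (one_div_pos.2 hM.one_sub_pos).le (by norm_num))
    linarith

/-- The performance difference lemma: the gain of `p` over `p₁` is the expected advantage of `p`
with respect to the `Q`-values of `p₁`, under the stationary distribution of `p`. -/
theorem HasMixingTime.avgReward_sub_eq (hM : M.HasMixingTime ω) (hp : IsPolicy p)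
    (h₁ : IsPolicy p₁) (h₂ : IsPolicy p₂) :
    M.avgReward p p₂ - M.avgReward p₁ p₂
      = M.statDist p p₂ ⬝ᵥ fun s => M.qValue p₁ p₂ s ⬝ᵥ (p s - p₁ s) := by
  have key : ∀ u : S → A₁ → ℝ, IsPolicy u → ∀ s, M.qValue p₁ p₂ s ⬝ᵥ u s
      = M.policyReward u p₂ s - M.avgReward p₁ p₂ + M.transMat u p₂ s ⬝ᵥ M.bias p₁ p₂ := by
    intro u hu s
    have e : M.qValue p₁ p₂ s = (M.expReward p₂ s - fun _ => M.avgReward p₁ p₂)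
        + Matrix.of (M.nextDist p₂ s) *ᵥ M.bias p₁ p₂ := by
      ext a
      rw [hM.qValue_eq h₁ h₂]
      rfl
    rw [e, dotProduct_comm, dotProduct_add, dotProduct_sub,
      dotProduct_const_of_mem_stdSimplex (hu s), Matrix.dotProduct_mulVec]
    rfl
  have e : (fun s => M.qValue p₁ p₂ s ⬝ᵥ (p s - p₁ s))
      = (M.policyReward p p₂ - fun _ => M.avgReward p₁ p₂)
        + (M.transMat p p₂ *ᵥ M.bias p₁ p₂ - M.bias p₁ p₂) := by
    ext s
    have h := hM.bias_eq h₁ h₂ s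
    rw [dotProduct_sub, key p hp, key p₁ h₁]
    simp only [Pi.add_apply, Pi.sub_apply, Matrix.mulVec]
    change _ = _ + (M.transMat p p₂ s ⬝ᵥ M.bias p₁ p₂ - _)
    linarith
  rw [e, dotProduct_add, dotProduct_sub, dotProduct_sub, Matrix.dotProduct_mulVec,
    (M.isStationary_statDist hM hp h₂).2.1,
    dotProduct_const_of_mem_stdSimplex (hM.statDist_mem hp h₂)]
  simp [avgReward]

/-! ### Sensitivity to changes of the policies -/

theorem HasMixingTime.l1Norm_statDist_sub_le (hM : M.HasMixingTime ω) (h₁ : IsPolicy p₁)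
    (h₂ : IsPolicy p₂) (h₁' : IsPolicy p₁') (h₂' : IsPolicy p₂') :
    l1Norm (M.statDist p₁ p₂ - M.statDist p₁' p₂')
      ≤ (rowNorm (p₁ - p₁') + M.influence₂ * rowNorm (p₂ - p₂'))
        / (1 - Real.exp (-(1 / ω))) := by
  rw [le_div_iff₀ hM.one_sub_pos]
  set d := M.statDist p₁ p₂ with hd
  set d' := M.statDist p₁' p₂' with hd'
  have hdm := hM.statDist_mem h₁ h₂
  have hdm' := hM.statDist_mem h₁' h₂'
  have e : d - d' = (d ᵥ* M.transMat p₁ p₂ - d' ᵥ* M.transMat p₁ p₂)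
      + d' ᵥ* (M.transMat p₁ p₂ - M.transMat p₁' p₂') := by
    rw [Matrix.vecMul_sub, hd, hd', (M.isStationary_statDist hM h₁ h₂).2.1,
      (M.isStationary_statDist hM h₁' h₂').2.1]
    abel
  have h := l1Norm_add_le (d ᵥ* M.transMat p₁ p₂ - d' ᵥ* M.transMat p₁ p₂)
      (d' ᵥ* (M.transMat p₁ p₂ - M.transMat p₁' p₂'))
  rw [← e] at h
  have h2 := hM.2 p₁ p₂ h₁ h₂ d hdm d' hdm'
  have h3 := l1Norm_vecMul_le d' (M.transMat p₁ p₂ - M.transMat p₁' p₂')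
    fun s => M.l1Norm_transMat_sub_le (p₁' := p₁') h₁ h₂ h₂' s
  rw [l1Norm_eq_one hdm', one_mul] at h3
  have h3' : l1Norm (d' ᵥ* (M.transMat p₁ p₂ - M.transMat p₁' p₂'))
    ≤ rowNorm (p₁ - p₁') + M.influence₂ * rowNorm (p₂ - p₂') := h3
  linarith

theorem HasMixingTime.abs_avgReward_sub_le (hM : M.HasMixingTime ω) (h₁ : IsPolicy p₁)
    (h₂ : IsPolicy p₂) (h₁' : IsPolicy p₁') (h₂' : IsPolicy p₂') :
    |M.avgReward p₁ p₂ - M.avgReward p₁' p₂'|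
      ≤ (rowNorm (p₁ - p₁') + M.influence₂ * rowNorm (p₂ - p₂')) / (1 - Real.exp (-(1 / ω)))
        + (rowNorm (p₁ - p₁') + rowNorm (p₂ - p₂')) := by
  have e : M.avgReward p₁ p₂ - M.avgReward p₁' p₂'
      = (M.statDist p₁ p₂ - M.statDist p₁' p₂') ⬝ᵥ M.policyReward p₁ p₂
        + M.statDist p₁' p₂' ⬝ᵥ (M.policyReward p₁ p₂ - M.policyReward p₁' p₂') := by
    rw [sub_dotProduct, dotProduct_sub]
    simp only [avgReward]
    ring
  rw [e]
  refine (abs_add_le _ _).trans (add_le_add ?_ ?_)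
  · refine (abs_dotProduct_le (c := 1) _ _ fun s => ?_).trans ?_
    · rw [abs_of_nonneg (M.policyReward_mem h₁ h₂ s).1]
      exact (M.policyReward_mem h₁ h₂ s).2
    · rw [mul_one]
      exact hM.l1Norm_statDist_sub_le h₁ h₂ h₁' h₂'
  · refine (abs_dotProduct_le _ _ fun s => M.abs_policyReward_sub_le h₁' h₂ s).trans ?_
    rw [l1Norm_eq_one (hM.statDist_mem h₁' h₂'), one_mul]

/-- The difference of two bias functions solves a Poisson equation itself. -/
theorem HasMixingTime.bias_sub_bias_osc_le (hM : M.HasMixingTime ω) (h₁ : IsPolicy p₁)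
    (h₂ : IsPolicy p₂) (h₁' : IsPolicy p₁') (h₂' : IsPolicy p₂') (s s' : S) :
    (M.bias p₁ p₂ - M.bias p₁' p₂') s - (M.bias p₁ p₂ - M.bias p₁' p₂') s'
      ≤ (2 * (rowNorm (p₁ - p₁') + rowNorm (p₂ - p₂'))
          + (rowNorm (p₁ - p₁') + M.influence₂ * rowNorm (p₂ - p₂')) / (1 - Real.exp (-(1 / ω))))
        / (1 - Real.exp (-(1 / ω))) := by
  refine hM.osc_le h₁ h₂ (V := M.bias p₁ p₂ - M.bias p₁' p₂')
    (f := fun s => (M.policyReward p₁ p₂ s - M.policyReward p₁' p₂' s)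
      - (M.avgReward p₁ p₂ - M.avgReward p₁' p₂')
      + (M.transMat p₁ p₂ s - M.transMat p₁' p₂' s) ⬝ᵥ M.bias p₁' p₂') ?_ ?_ s s'
  · intro s
    have h := hM.bias_eq h₁ h₂ s
    have h' := hM.bias_eq h₁' h₂' s
    simp only [Pi.sub_apply, sub_dotProduct, dotProduct_sub]
    linarith
  · intro s s'
    have hr := fun s => abs_le.1 (M.abs_policyReward_sub_le (p₁ := p₁) (p₂' := p₂') h₁' h₂ s)
    have ht : ∀ s, |(M.transMat p₁ p₂ s - M.transMat p₁' p₂' s) ⬝ᵥ M.bias p₁' p₂'|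
        ≤ (rowNorm (p₁ - p₁') + M.influence₂ * rowNorm (p₂ - p₂'))
          * (1 / (1 - Real.exp (-(1 / ω))) / 2) := by
      intro s
      refine (abs_sub_dotProduct_le_of_osc
        ((M.transMat_mem h₁ h₂ s).2.trans (M.transMat_mem h₁' h₂' s).2.symm)
        (hM.bias_sub_le h₁' h₂')).trans ?_
      exact mul_le_mul_of_nonneg_right (M.l1Norm_transMat_sub_le h₁ h₂ h₂' s)
        (div_nonneg (one_div_pos.2 hM.one_sub_pos).le (by norm_num))
    have h1 := hr s
    have h2 := hr s'
    have h3 := abs_le.1 (ht s)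
    have h4 := abs_le.1 (ht s')
    have e : (rowNorm (p₁ - p₁') + M.influence₂ * rowNorm (p₂ - p₂')) / (1 - Real.exp (-(1 / ω)))
        = 2 * ((rowNorm (p₁ - p₁') + M.influence₂ * rowNorm (p₂ - p₂'))
          * (1 / (1 - Real.exp (-(1 / ω))) / 2)) := by ring
    rw [e]
    linarith [h1.2, h2.1, h3.2, h4.1]

/-- The `Q`-values change by at most `C_Q` when the policies change by `ρ₁` and `ρ₂`. -/
theorem HasMixingTime.abs_qValue_sub_le (hM : M.HasMixingTime ω) (h₁ : IsPolicy p₁)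
    (h₂ : IsPolicy p₂) (h₁' : IsPolicy p₁') (h₂' : IsPolicy p₂') {ρ₁ ρ₂ : ℝ}
    (hρ₁ : rowNorm (p₁ - p₁') ≤ ρ₁) (hρ₂ : rowNorm (p₂ - p₂') ≤ ρ₂) (s : S) (a : A₁) :
    |M.qValue p₁ p₂ s a - M.qValue p₁' p₂' s a| ≤ cQ ω M.influence₂ ρ₁ ρ₂ := by
  have hx := M.nextDist_mem (a := a) h₂ s
  have hx' := M.nextDist_mem (a := a) h₂' s
  have hd := hM.statDist_mem h₁ h₂
  have hd' := hM.statDist_mem h₁' h₂'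
  set x := M.nextDist p₂ s a
  set x' := M.nextDist p₂' s a
  set d := M.statDist p₁ p₂
  set d' := M.statDist p₁' p₂'
  have hz : d ⬝ᵥ M.bias p₁ p₂ = 0 := hM.statDist_dotProduct_bias h₁ h₂
  have hz' : d' ⬝ᵥ M.bias p₁' p₂' = 0 := hM.statDist_dotProduct_bias h₁' h₂'
  have e : M.qValue p₁ p₂ s a - M.qValue p₁' p₂' s a
      = (M.expReward p₂ s a - M.expReward p₂' s a)
        - (M.avgReward p₁ p₂ - M.avgReward p₁' p₂')
        + (x - d) ⬝ᵥ (M.bias p₁ p₂ - M.bias p₁' p₂')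
        + (x - x') ⬝ᵥ M.bias p₁' p₂' - (d - d') ⬝ᵥ M.bias p₁' p₂' := by
    rw [hM.qValue_eq h₁ h₂, hM.qValue_eq h₁' h₂']
    simp only [sub_dotProduct, dotProduct_sub]
    linarith
  have hpos := hM.one_sub_pos
  set z := 1 - Real.exp (-(1 / ω)) with hzdef
  have hI := M.influence₂_nonneg
  have hIρ : M.influence₂ * rowNorm (p₂ - p₂') ≤ M.influence₂ * ρ₂ :=
    mul_le_mul_of_nonneg_left hρ₂ hI
  have hz0 : 0 ≤ 1 / z := (one_div_pos.2 hpos).le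
  have hz1 : 1 ≤ 1 / z := by
    rw [le_div_iff₀ hpos]
    have := Real.exp_pos (-(1 / ω))
    linarith
  have hρ₁0 : 0 ≤ ρ₁ := (rowNorm_nonneg _).trans hρ₁
  have hρ₂0 : 0 ≤ ρ₂ := (rowNorm_nonneg _).trans hρ₂
  have hIρ0 : 0 ≤ M.influence₂ * ρ₂ := mul_nonneg hI hρ₂0
  -- bounds for the five summands of `e`
  have b1 : |M.expReward p₂ s a - M.expReward p₂' s a| ≤ ρ₂ :=
    (M.abs_expReward_sub_le p₂ p₂' s a).trans hρ₂
  have b2 : |M.avgReward p₁ p₂ - M.avgReward p₁' p₂'|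
      ≤ (ρ₁ + M.influence₂ * ρ₂) * (1 / z) + (ρ₁ + ρ₂) := by
    refine (hM.abs_avgReward_sub_le h₁ h₂ h₁' h₂').trans ?_
    rw [div_eq_mul_one_div]
    gcongr
  have b3 : |(x - d) ⬝ᵥ (M.bias p₁ p₂ - M.bias p₁' p₂')|
      ≤ (2 * (ρ₁ + ρ₂) + (ρ₁ + M.influence₂ * ρ₂) * (1 / z)) * (1 / z) := by
    have h := abs_sub_dotProduct_le_of_osc (hx.2.trans hd.2.symm)
      (hM.bias_sub_bias_osc_le h₁ h₂ h₁' h₂')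
    have hB : (2 * (rowNorm (p₁ - p₁') + rowNorm (p₂ - p₂'))
          + (rowNorm (p₁ - p₁') + M.influence₂ * rowNorm (p₂ - p₂')) / z) / z
        ≤ (2 * (ρ₁ + ρ₂) + (ρ₁ + M.influence₂ * ρ₂) * (1 / z)) * (1 / z) := by
      rw [div_eq_mul_one_div, div_eq_mul_one_div (_ + _) z]
      gcongr
    refine h.trans ?_
    have h0 : 0 ≤ (2 * (ρ₁ + ρ₂) + (ρ₁ + M.influence₂ * ρ₂) * (1 / z)) * (1 / z) := by positivity
    calc _ ≤ l1Norm (x - d)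
          * ((2 * (ρ₁ + ρ₂) + (ρ₁ + M.influence₂ * ρ₂) * (1 / z)) * (1 / z) / 2) :=
          mul_le_mul_of_nonneg_left (by linarith) (l1Norm_nonneg _)
      _ ≤ 2 * ((2 * (ρ₁ + ρ₂) + (ρ₁ + M.influence₂ * ρ₂) * (1 / z)) * (1 / z) / 2) :=
          mul_le_mul_of_nonneg_right (l1Norm_sub_le_two hx hd) (by linarith)
      _ = _ := by ring
  have b4 : |(x - x') ⬝ᵥ M.bias p₁' p₂'| ≤ M.influence₂ * ρ₂ * (1 / z / 2) := by
    refine (abs_sub_dotProduct_le_of_osc (hx.2.trans hx'.2.symm) (hM.bias_sub_le h₁' h₂')).trans ?_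
    exact mul_le_mul_of_nonneg_right ((M.l1Norm_nextDist_sub_le h₂ h₂' s a).trans hIρ)
      (by linarith)
  have b5 : |(d - d') ⬝ᵥ M.bias p₁' p₂'|
      ≤ (ρ₁ + M.influence₂ * ρ₂) * (1 / z) * (1 / z / 2) := by
    refine (abs_sub_dotProduct_le_of_osc (hd.2.trans hd'.2.symm) (hM.bias_sub_le h₁' h₂')).trans ?_
    refine mul_le_mul_of_nonneg_right ((hM.l1Norm_statDist_sub_le h₁ h₂ h₁' h₂').trans ?_)
      (by linarith)
    rw [div_eq_mul_one_div]
    gcongr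
  have hc : cQ ω M.influence₂ ρ₁ ρ₂
      = 3 * (ρ₁ + M.influence₂ * ρ₂) * (1 / z) * (1 / z) + 2 * (ρ₁ + ρ₂) * (1 / z)
        + (3 * (1 / z) + 1) * ρ₁ + 2 * ρ₂ + (ρ₁ + M.influence₂ * ρ₂) * (1 / z) := by
    unfold cQ cQPi
    rw [← hzdef]
    field_simp
  rw [e, hc]
  have h6 : M.influence₂ * ρ₂ * (1 / z) ≤ M.influence₂ * ρ₂ * (1 / z) * (1 / z) :=
    le_mul_of_one_le_right (by positivity) hz1
  have h7 : 0 ≤ ρ₁ * (1 / z) * (1 / z) := by positivity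
  have h8 : 0 ≤ ρ₁ * (1 / z) := by positivity
  have h9 : 0 ≤ M.influence₂ * ρ₂ * (1 / z) * (1 / z) := by positivity
  have c1 := abs_le.1 b1
  have c2 := abs_le.1 b2
  have c3 := abs_le.1 b3
  have c4 := abs_le.1 b4
  have c5 := abs_le.1 b5
  rw [abs_le]
  constructor
  · linarith [c1.1, c2.2, c3.1, c4.1, c5.2]
  · linarith [c1.2, c2.1, c3.2, c4.2, c5.1]

end bias

end TwoAgentMDP

/-! ### Windowed optimistic follow-the-regularized-leader -/

/-- Summed over a `T × Γ` rectangle, the differences along the diagonals telescope; there are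
`T + Γ - 1` diagonals, each of which enters through the row `1` or the column `1`. -/
theorem sum_sum_sub_diag_le {G : ℕ → ℕ → ℝ} {T Γ : ℕ} {a b : ℝ} (hT : 1 ≤ T) (hΓ : 1 ≤ Γ)
    (hrow : ∀ τ, G 1 τ ≤ a) (hcol : ∀ t, 1 ≤ t → t ≤ T → G t 1 ≤ a)
    (hend : ∀ t τ, 1 ≤ t → t ≤ T + 1 → 2 ≤ τ → -b ≤ G t τ) :
    ∑ t ∈ Finset.Icc 1 T, ∑ τ ∈ Finset.Icc 1 Γ, (G t τ - G (t + 1) (τ + 1))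
      ≤ ((T : ℝ) + Γ - 1) * (a + b) := by
  have key : ∀ n : ℕ, n + 1 ≤ T →
      ∑ t ∈ Finset.Icc 1 (n + 1), ∑ τ ∈ Finset.Icc 1 Γ, (G t τ - G (t + 1) (τ + 1))
        + ∑ τ ∈ Finset.Icc 1 Γ, G (n + 2) (τ + 1) ≤ ((n : ℝ) + Γ) * a + n * b := by
    intro n
    induction n with
    | zero =>
      intro _
      have h := Finset.sum_le_card_nsmul (Finset.Icc 1 Γ) (G 1) a fun τ _ => hrow τ
      simp only [Nat.card_Icc, Nat.add_sub_cancel, nsmul_eq_mul] at h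
      simpa [Finset.sum_sub_distrib] using h
    | succ n ih =>
      intro hn
      rw [Finset.sum_Icc_succ_top (by omega), Finset.sum_sub_distrib]
      have h := ih (by omega)
      have e : ∑ τ ∈ Finset.Icc 1 Γ, G (n + 2) (τ + 1) + G (n + 2) 1
          = ∑ τ ∈ Finset.Icc 1 Γ, G (n + 2) τ + G (n + 2) (Γ + 1) := by
        rw [← Finset.sum_Icc_succ_top (f := G (n + 2)) (by omega : 1 ≤ Γ + 1),
          ← Finset.add_sum_Ioc_eq_sum_Icc (by omega : 1 ≤ Γ + 1), add_comm]
        congr 1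
        refine Finset.sum_bij (fun i _ => i + 1) (fun i hi => ?_) (fun i _ j _ hij => ?_)
          (fun i hi => ⟨i - 1, ?_, ?_⟩) (fun i _ => rfl)
        · simp only [Finset.mem_Icc, Finset.mem_Ioc] at *; omega
        · omega
        · simp only [Finset.mem_Icc, Finset.mem_Ioc] at *; omega
        · simp only [Finset.mem_Ioc] at hi; omega
      have h1 := hcol (n + 2) (by omega) (by omega)
      have h2 := hend (n + 2) (Γ + 1) (by omega) (by omega) (by omega)
      push_cast
      simp only [add_assoc, Nat.reduceAdd] at *
      linarith
  obtain ⟨n, rfl⟩ := Nat.exists_eq_add_of_le' hT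
  have h := key n le_rfl
  have h2 := Finset.card_nsmul_le_sum (Finset.Icc 1 Γ) (fun τ => G (n + 2) (τ + 1)) (-b)
    fun τ hτ => hend _ _ (by omega) (by omega) (by simp only [Finset.mem_Icc] at hτ; omega)
  simp only [Nat.card_Icc, Nat.add_sub_cancel, nsmul_eq_mul] at h2
  push_cast
  linarith

theorem l1Norm_sub_le_of_drift {ι : Type*} [Fintype ι] {d : ℕ → ι → ℝ} {T : ℕ} {D : ℝ}
    (hd : ∀ t, 1 ≤ t → t + 1 ≤ T → l1Norm (d (t + 1) - d t) ≤ D) {u : ℕ} (hu : 1 ≤ u) (n : ℕ)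
    (hn : u + n ≤ T) : l1Norm (d (u + n) - d u) ≤ n * D := by
  induction n with
  | zero => simp [l1Norm]
  | succ n ih =>
    have h := l1Norm_sub_le_sub_add_sub (d (u + (n + 1))) (d (u + n)) (d u)
    have h1 := hd (u + n) (by omega) (by omega)
    have h2 := ih (by omega)
    rw [← add_assoc] at h ⊢
    push_cast
    linarith

section windowed

variable {S A : Type*}

/-- The sum of the `τ - 1` payoffs before episode `t`. -/
def recentSum (Q : ℕ → S → A → ℝ) (t τ : ℕ) (s : S) : A → ℝ :=
  ∑ j ∈ Finset.Icc 1 (τ - 1), Q (t - j) s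

theorem recentSum_one_right (Q : ℕ → S → A → ℝ) (t : ℕ) (s : S) : recentSum Q t 1 s = 0 := by
  simp [recentSum]

theorem recentSum_one_left {Q : ℕ → S → A → ℝ} (hQ : Q 0 = 0) (τ : ℕ) (s : S) :
    recentSum Q 1 τ s = 0 := by
  refine Finset.sum_eq_zero fun j hj => ?_
  have : 1 - j = 0 := by simp only [Finset.mem_Icc] at hj; omega
  rw [this, hQ]
  rfl

theorem recentSum_succ_succ (Q : ℕ → S → A → ℝ) (t : ℕ) {τ : ℕ} (hτ : 1 ≤ τ) (s : S) :
    recentSum Q (t + 1) (τ + 1) s = recentSum Q t τ s + Q t s := by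
  obtain ⟨n, rfl⟩ := Nat.exists_eq_add_of_le' hτ
  unfold recentSum
  simp only [Nat.add_sub_cancel]
  rw [← Finset.sum_Ioc_add_eq_sum_Icc (by omega : 1 ≤ n + 1)]
  congr 1
  refine (Finset.sum_bij (fun i _ => i + 1) (fun i hi => ?_) (fun i _ j _ hij => ?_)
    (fun i hi => ⟨i - 1, ?_, ?_⟩) (fun i hi => ?_)).symm
  · simp only [Finset.mem_Icc, Finset.mem_Ioc] at *; omega
  · omega
  · simp only [Finset.mem_Icc, Finset.mem_Ioc] at *; omega
  · simp only [Finset.mem_Ioc] at hi; omega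
  · rw [Nat.add_sub_add_right]

variable [Fintype S] [Fintype A]

/-- The regret of windowed optimistic follow-the-regularized-leader in the states `s`, weighted by
slowly changing distributions `d t` of the states. Apart from the usual terms there are the price
`2 K D` per episode and unit of the window for freezing the weights at the start of each window,
and the price `K ρ` for the first payoff, which no prediction announces. -/
theorem windowed_regret_le [Nonempty A] {R : (A → ℝ) → ℝ} (hR : IsRegularizer R)
    (hb : BddBelow (R '' stdSimplex ℝ A)) {ε : ℝ} (hε : 0 < ε) {T Γ : ℕ} (hT : 2 ≤ T) (hΓ : 1 ≤ Γ)
    {Q : ℕ → S → A → ℝ} (hQ0 : Q 0 = 0) {w : ℕ → ℕ → S → A → ℝ} {π : ℕ → S → A → ℝ}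
    (hw : ∀ t ∈ Finset.Icc 1 T, ∀ τ ∈ Finset.Icc 1 Γ, ∀ s, w t τ s ∈ stdSimplex ℝ A)
    (hmax : ∀ t ∈ Finset.Icc 1 T, ∀ τ ∈ Finset.Icc 1 Γ, ∀ s,
      IsMaxOn (leaderObj R ε (recentSum Q t τ s + Q (t - 1) s)) (stdSimplex ℝ A) (w t τ s))
    (hπ : ∀ t ∈ Finset.Icc 1 T, ∀ s, π t s = (1 / (Γ : ℝ)) • ∑ τ ∈ Finset.Icc 1 Γ, w t τ s)
    {d : ℕ → S → ℝ} (hd : ∀ t ∈ Finset.Icc 1 T, d t ∈ stdSimplex ℝ S) {D K C ρ : ℝ} (hD : 0 ≤ D)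
    (hK : 0 ≤ K)
    (hdD : ∀ t, 1 ≤ t → t + 1 ≤ T → l1Norm (d (t + 1) - d t) ≤ D)
    (hQK : ∀ t ∈ Finset.Icc 1 T, ∀ s a, |Q t s a| ≤ K)
    (hQC : ∀ t, 1 ≤ t → t + 1 ≤ T → ∀ s a, |Q (t + 1) s a - Q t s a| ≤ C)
    (hρ : rowNorm (π 2 - π 1) ≤ ρ) {p : S → A → ℝ} (hp : IsPolicy p) :
    ∑ t ∈ Finset.Icc 1 T, d t ⬝ᵥ (fun s => Q t s ⬝ᵥ (p s - π t s))
      ≤ (1 / (Γ : ℝ)) * (((T : ℝ) + Γ - 1) * (regRange R / ε)) + T * (ε / 2 * C ^ 2) + K * ρ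
        + 2 * K * D * T * Γ := by
  have hΓ0 : (0 : ℝ) < Γ := by exact_mod_cast hΓ
  have m1 : 1 ∈ Finset.Icc 1 T := Finset.mem_Icc.2 ⟨le_rfl, by omega⟩
  have m2 : 2 ∈ Finset.Icc 1 T := Finset.mem_Icc.2 ⟨by omega, hT⟩
  have n1 : 1 ∈ Finset.Icc 1 Γ := Finset.mem_Icc.2 ⟨le_rfl, hΓ⟩
  -- the window to which `(t, τ)` belongs starts in episode `max 1 (t + 1 - τ)`
  set e : ℕ → ℕ → S → ℝ := fun t τ => d (max 1 (t + 1 - τ)) with he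
  set Ψ : ℕ → ℕ → S → ℝ := fun t τ s =>
    leaderValue R ε (recentSum Q t τ s) - recentSum Q t τ s ⬝ᵥ p s with hΨ
  set G : ℕ → ℕ → ℝ := fun t τ => e t τ ⬝ᵥ Ψ t τ with hG
  set x : ℕ → ℕ → S → ℝ := fun t τ s => Q t s ⬝ᵥ (p s - w t τ s) with hx
  set y : ℕ → ℝ := fun τ => d 1 ⬝ᵥ fun s => Q 1 s ⬝ᵥ (w 2 1 s - w 1 τ s) with hy
  have hdiff : ∀ t ∈ Finset.Icc 1 T, ∀ τ ∈ Finset.Icc 1 Γ,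
      d t ⬝ᵥ x t τ ≤ e t τ ⬝ᵥ x t τ + 2 * K * D * Γ := by
    intro t ht τ hτ
    have h1 : l1Norm (d t - e t τ) ≤ Γ * D := by
      simp only [Finset.mem_Icc] at ht hτ
      have h := l1Norm_sub_le_of_drift hdD (u := max 1 (t + 1 - τ)) (by omega)
        (t - max 1 (t + 1 - τ)) (by omega)
      have e1 : max 1 (t + 1 - τ) + (t - max 1 (t + 1 - τ)) = t := by omega
      rw [e1] at h
      refine h.trans (mul_le_mul_of_nonneg_right ?_ hD)
      exact_mod_cast (by omega : t - max 1 (t + 1 - τ) ≤ Γ)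
    have h2 : ∀ s, |x t τ s| ≤ 2 * K := by
      intro s
      rw [hx]
      dsimp only
      rw [dotProduct_comm]
      exact (abs_dotProduct_le _ _ fun a => hQK t ht s a).trans
        (mul_le_mul_of_nonneg_right (l1Norm_sub_le_two (hp s) (hw t ht τ hτ s)) hK)
    have h3 := (le_abs_self _).trans (abs_dotProduct_le (d t - e t τ) (x t τ) h2)
    rw [sub_dotProduct] at h3
    have h4 := mul_le_mul_of_nonneg_right h1 (by positivity : 0 ≤ 2 * K)
    linarith
  have hem : ∀ t ∈ Finset.Icc 1 T, ∀ τ, 1 ≤ τ → e t τ ∈ stdSimplex ℝ S := by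
    intro t ht τ hτ
    refine hd _ ?_
    simp only [Finset.mem_Icc] at ht ⊢
    omega
  have hstep : ∀ t ∈ Finset.Icc 1 T, ∀ τ ∈ Finset.Icc 1 Γ,
      e t τ ⬝ᵥ x t τ ≤ (G t τ - G (t + 1) (τ + 1)) + ε / 2 * C ^ 2 + if t = 1 then y τ else 0 := by
    intro t ht τ hτ
    have hτ1 : 1 ≤ τ := (Finset.mem_Icc.1 hτ).1
    have he' : e (t + 1) (τ + 1) = e t τ := by
      simp only [he, Nat.add_sub_add_right]
    have hΨ' : ∀ s, Ψ (t + 1) (τ + 1) s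
        = leaderValue R ε (recentSum Q t τ s + Q t s) - recentSum Q t τ s ⬝ᵥ p s
          - Q t s ⬝ᵥ p s := by
      intro s
      simp only [hΨ]
      rw [recentSum_succ_succ Q t hτ1, add_dotProduct]
      ring
    have hC0 : 0 ≤ ε / 2 * C ^ 2 := by positivity
    have hGsub : G t τ - G (t + 1) (τ + 1) = e t τ ⬝ᵥ (Ψ t τ - Ψ (t + 1) (τ + 1)) := by
      simp only [hG]
      rw [he', dotProduct_sub]
    rw [hGsub]
    by_cases h1 : t = 1
    · subst h1
      rw [if_pos rfl]
      have e1 : e 1 τ = d 1 := by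
        simp only [he]
        congr 1
        omega
      have h : e 1 τ ⬝ᵥ (x 1 τ - (Ψ 1 τ - Ψ (1 + 1) (τ + 1))
          - fun s => Q 1 s ⬝ᵥ (w 2 1 s - w 1 τ s)) ≤ 0 := by
        refine dotProduct_le_of_mem_stdSimplex (hem 1 ht τ hτ1) fun s => ?_
        -- `w 2 1` attains the optimal value against the first payoff
        have h2 : leaderValue R ε (Q 1 s) ≤ Q 1 s ⬝ᵥ w 2 1 s + leaderValue R ε 0 := by
          have hm := hmax 2 m2 1 n1 s
          rw [recentSum_one_right, zero_add] at hm
          have h3 := leaderObj_le_leaderValue hb hε 0 (hw 2 m2 1 n1 s)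
          have h4 : leaderValue R ε (Q 1 s) ≤ leaderObj R ε (Q 1 s) (w 2 1 s) :=
            leaderValue_le fun v hv => hm hv
          simp only [leaderObj, zero_dotProduct] at h3 h4
          linarith
        simp only [Pi.sub_apply]
        rw [hΨ' s]
        simp only [hΨ, hx, dotProduct_sub]
        rw [recentSum_one_left hQ0, zero_add, zero_dotProduct]
        linarith
      rw [dotProduct_sub, dotProduct_sub] at h
      simp only [hy]
      rw [e1] at h ⊢
      linarith
    · rw [if_neg h1, add_zero]
      have h : e t τ ⬝ᵥ (x t τ - (Ψ t τ - Ψ (t + 1) (τ + 1))) ≤ ε / 2 * C ^ 2 := by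
        refine dotProduct_le_of_mem_stdSimplex (hem t ht τ hτ1) fun s => ?_
        have ht' := Finset.mem_Icc.1 ht
        have hc : ∀ a, |Q t s a - Q (t - 1) s a| ≤ C := by
          have h := hQC (t - 1) (by omega) (by omega) s
          rwa [Nat.sub_add_cancel ht'.1] at h
        have h3 := hR.leaderValue_add_le hb hε (hw t ht τ hτ s) (hmax t ht τ hτ s) hc
        simp only [Pi.sub_apply]
        rw [hΨ' s]
        simp only [hΨ, hx, dotProduct_sub]
        linarith
      rw [dotProduct_sub] at h
      linarith
  have hdiag : ∑ t ∈ Finset.Icc 1 T, ∑ τ ∈ Finset.Icc 1 Γ, (G t τ - G (t + 1) (τ + 1))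
      ≤ ((T : ℝ) + Γ - 1) * (regRange R / ε) := by
    have hstart : ∀ t ∈ Finset.Icc 1 T, ∀ τ, 1 ≤ τ → (∀ s, recentSum Q t τ s = 0) →
        G t τ ≤ -(sInf (R '' stdSimplex ℝ A) / ε) := by
      intro t ht τ hτ h0
      refine dotProduct_le_of_mem_stdSimplex (hem t ht τ hτ) fun s => ?_
      simp only [hΨ, h0, zero_dotProduct, sub_zero]
      exact leaderValue_zero_le hb hε
    have h := sum_sum_sub_diag_le (G := fun t τ => G t (max 1 τ)) (T := T) (Γ := Γ)
      (a := -(sInf (R '' stdSimplex ℝ A) / ε)) (b := sSup (R '' stdSimplex ℝ A) / ε)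
      (by omega) hΓ (fun τ => ?_) (fun t h1 h2 => ?_) (fun t τ h1 h2 hτ => ?_)
    · have e1 : -(sInf (R '' stdSimplex ℝ A) / ε) + sSup (R '' stdSimplex ℝ A) / ε
          = regRange R / ε := by
        unfold regRange; ring
      rw [e1] at h
      refine le_of_eq_of_le ?_ h
      refine Finset.sum_congr rfl fun t _ => Finset.sum_congr rfl fun τ hτ => ?_
      have hτ1 := (Finset.mem_Icc.1 hτ).1
      rw [max_eq_right hτ1, max_eq_right (by omega)]
    · exact hstart 1 m1 _ (le_max_left _ _) fun s => recentSum_one_left hQ0 _ s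
    · exact hstart t (Finset.mem_Icc.2 ⟨h1, h2⟩) _ (le_max_left _ _)
        fun s => recentSum_one_right Q t s
    · refine le_dotProduct_of_mem_stdSimplex (hd _ (Finset.mem_Icc.2 ?_))
        fun s => le_leaderValue_sub hR hb hε _ (hp s)
      omega
  have hyΓ : ∑ τ ∈ Finset.Icc 1 Γ, y τ ≤ Γ * (K * ρ) := by
    have hsum : ∀ t ∈ Finset.Icc 1 T, ∀ s, ∑ τ ∈ Finset.Icc 1 Γ, Q 1 s ⬝ᵥ w t τ s
        = Γ * (Q 1 s ⬝ᵥ π t s) := by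
      intro t ht s
      rw [hπ t ht s, dotProduct_smul, dotProduct_sum, smul_eq_mul]
      field_simp
    have e1 : ∑ τ ∈ Finset.Icc 1 Γ, y τ
        = d 1 ⬝ᵥ fun s => ∑ τ ∈ Finset.Icc 1 Γ, Q 1 s ⬝ᵥ (w 2 1 s - w 1 τ s) := by
      simp only [hy, dotProduct]
      rw [Finset.sum_comm]
      simp only [Finset.mul_sum]
    rw [e1]
    refine dotProduct_le_of_mem_stdSimplex (hd 1 m1) fun s => ?_
    have h1 : ∑ τ ∈ Finset.Icc 1 Γ, Q 1 s ⬝ᵥ (w 2 1 s - w 1 τ s)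
        ≤ ∑ τ ∈ Finset.Icc 1 Γ, (Q 1 s ⬝ᵥ w 2 τ s - Q 1 s ⬝ᵥ w 1 τ s) := by
      refine Finset.sum_le_sum fun τ hτ => ?_
      rw [dotProduct_sub]
      refine sub_le_sub_right ?_ _
      rcases eq_or_ne τ 1 with rfl | hne
      · rfl
      · -- in episode `2` all longer windows see the first payoff twice
        have hg := hmax 2 m2 1 n1 s
        rw [recentSum_one_right, zero_add] at hg
        have hm := hmax 2 m2 τ hτ s
        have hτ' := Finset.mem_Icc.1 hτ
        obtain ⟨n, rfl⟩ : ∃ n, τ = n + 1 := ⟨τ - 1, by omega⟩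
        rw [recentSum_succ_succ Q 1 (by omega : 1 ≤ n), recentSum_one_left hQ0, zero_add] at hm
        exact dotProduct_leader_mono (hw 2 m2 1 n1 s) (hw 2 m2 _ hτ s) hg hm
    refine h1.trans ?_
    rw [Finset.sum_sub_distrib, hsum 2 m2, hsum 1 m1, ← mul_sub, ← dotProduct_sub]
    refine mul_le_mul_of_nonneg_left ?_ hΓ0.le
    rw [dotProduct_comm, mul_comm]
    refine (le_abs_self _).trans ((abs_dotProduct_le _ _ fun a => hQK 1 m1 s a).trans ?_)
    exact mul_le_mul_of_nonneg_right ((l1Norm_le_rowNorm (π 2 - π 1) s).trans hρ) hK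
  have havg : ∀ t ∈ Finset.Icc 1 T, d t ⬝ᵥ (fun s => Q t s ⬝ᵥ (p s - π t s))
      = (1 / (Γ : ℝ)) * ∑ τ ∈ Finset.Icc 1 Γ, d t ⬝ᵥ x t τ := by
    intro t ht
    rw [← dotProduct_sum, ← smul_eq_mul, ← dotProduct_smul]
    congr 1
    ext s
    simp only [Pi.smul_apply, Finset.sum_apply, hx, dotProduct_sub, Finset.sum_sub_distrib,
      Finset.sum_const, Nat.card_Icc, Nat.add_sub_cancel, nsmul_eq_mul, smul_eq_mul]
    rw [hπ t ht s, dotProduct_smul, dotProduct_sum, smul_eq_mul, mul_sub]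
    congr 1
    field_simp
  rw [Finset.sum_congr rfl havg, ← Finset.mul_sum]
  have htotal : ∑ t ∈ Finset.Icc 1 T, ∑ τ ∈ Finset.Icc 1 Γ, d t ⬝ᵥ x t τ
      ≤ ((T : ℝ) + Γ - 1) * (regRange R / ε) + T * (Γ * (ε / 2 * C ^ 2)) + Γ * (K * ρ)
        + T * (Γ * (2 * K * D * Γ)) := by
    calc _ ≤ ∑ t ∈ Finset.Icc 1 T, ∑ τ ∈ Finset.Icc 1 Γ, ((G t τ - G (t + 1) (τ + 1))
            + ε / 2 * C ^ 2 + (if t = 1 then y τ else 0) + 2 * K * D * Γ) :=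
          Finset.sum_le_sum fun t ht => Finset.sum_le_sum fun τ hτ =>
            (hdiff t ht τ hτ).trans (add_le_add_left (hstep t ht τ hτ) _)
      _ = ∑ t ∈ Finset.Icc 1 T, ∑ τ ∈ Finset.Icc 1 Γ, (G t τ - G (t + 1) (τ + 1))
            + T * (Γ * (ε / 2 * C ^ 2)) + ∑ τ ∈ Finset.Icc 1 Γ, y τ
            + T * (Γ * (2 * K * D * Γ)) := by
          have hite : ∑ t ∈ Finset.Icc 1 T, ∑ τ ∈ Finset.Icc 1 Γ, (if t = 1 then y τ else 0)
              = ∑ τ ∈ Finset.Icc 1 Γ, y τ := by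
            rw [Finset.sum_comm]
            refine Finset.sum_congr rfl fun τ _ => ?_
            rw [Finset.sum_ite_eq' (Finset.Icc 1 T) 1 fun _ => y τ, if_pos m1]
          rw [← hite]
          simp only [Finset.sum_add_distrib, Finset.sum_const, Nat.card_Icc, Nat.add_sub_cancel,
            nsmul_eq_mul]
      _ ≤ _ := by gcongr
  refine (mul_le_mul_of_nonneg_left htotal (by positivity)).trans_eq ?_
  field_simp

end windowed

/-! ### The regret of ExpDRBias -/

open TwoAgentMDP

/-- The numerical comparison at the learning rate `1 / g`, `g = Γ ^ (1 / 4)`. The price `κ / g`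
of the first payoff is paid for by the diagonal that `T + Γ - 1` saves against `2 T`, by means of
`Δ ≥ 1 / 2` and the inequality of the means. -/
theorem learning_rate_bound {T g Δ κ : ℝ} (hg : 0 < g) (hT : g ^ 4 ≤ T) (hΔ : 1 / 2 ≤ Δ) :
    1 / g ^ 4 * ((T + g ^ 4 - 1) * (Δ / (1 / g))) + T * (1 / g / 2 * (κ * (1 / g)) ^ 2)
      + κ * (1 / g) ≤ 2 * (Δ + κ ^ 2) * T * (1 / g ^ 3) := by
  have h : (T + g ^ 4 - 1) * Δ + T * κ ^ 2 / 2 + κ * g ^ 2 ≤ 2 * (Δ + κ ^ 2) * T := by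
    nlinarith [sq_nonneg (κ * g ^ 2 - 1), mul_nonneg (sub_nonneg.2 hT) (sub_nonneg.2 hΔ),
      mul_nonneg (sub_nonneg.2 hT) (sq_nonneg κ), sq_nonneg (κ * g ^ 2)]
  calc _ = ((T + g ^ 4 - 1) * Δ + T * κ ^ 2 / 2 + κ * g ^ 2) * (1 / g ^ 3) := by
        field_simp
    _ ≤ _ := mul_le_mul_of_nonneg_right h (by positivity)

theorem mainTheorem2 {S A₁ A₂ : Type*} [Fintype S] [Fintype A₁] [Fintype A₂]
    [DecidableEq S] [Nonempty S] [Nonempty A₁] [Nonempty A₂]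
    (M : TwoAgentMDP S A₁ A₂) (ω : ℝ) (hω : M.HasMixingTime ω)
    (R : (A₁ → ℝ) → ℝ) (hR : IsRegularizer R)
    (T Γ : ℕ) (hΓ : 1 ≤ Γ) (hΓT : Γ ≤ T)
    (ε : ℝ) (hε : ε = 1 / (Γ : ℝ) ^ (1 / 4 : ℝ))
    (π₁ : ℕ → S → A₁ → ℝ) (π₂ : ℕ → S → A₂ → ℝ)
    (hπ₂ : ∀ t ∈ Finset.Icc 1 T, IsPolicy (π₂ t))
    (halg : M.IsExpDRBias R ε Γ T π₁ π₂)
    (ρ₁ ρ₂ : ℝ) (hρ₁ : ρ₁ = policyChange T π₁) (hρ₂ : ρ₂ = policyChange T π₂)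
    (k : ℝ) (hk : 0 < k) (hkρ₁ : ρ₁ ≤ k * ε) (hkρ₂ : ρ₂ ≤ k * ε)
    (Cω : ℝ) (hCω : cQ ω M.influence₂ ρ₁ ρ₂ / max ρ₁ ρ₂ ≤ Cω)
    (hCω' : ρ₁ = 0 → ρ₂ = 0 → 1 ≤ Cω) :
    M.regret T π₁ π₂ ≤
      2 * (regRange R + k ^ 2 * Cω ^ 2) * T * (Γ : ℝ) ^ (-(3 / 4) : ℝ)
        + 6 * M.influence₂ * ρ₂ / (1 - Real.exp (-(1 / ω))) ^ 2 * T * Γ := by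
  classical
  obtain ⟨w, halg⟩ := halg
  have hΓ0 : (0 : ℝ) < Γ := by exact_mod_cast hΓ
  have m1 : 1 ∈ Finset.Icc 1 T := Finset.mem_Icc.2 ⟨le_rfl, by omega⟩
  have n1 : 1 ∈ Finset.Icc 1 Γ := Finset.mem_Icc.2 ⟨le_rfl, hΓ⟩
  set g : ℝ := (Γ : ℝ) ^ (1 / 4 : ℝ) with hg
  have hg0 : 0 < g := Real.rpow_pos_of_pos hΓ0 _
  have hg4 : g ^ 4 = Γ := by
    rw [hg, ← Real.rpow_natCast, ← Real.rpow_mul hΓ0.le]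
    norm_num
  have hg3 : (Γ : ℝ) ^ (-(3 / 4) : ℝ) = 1 / g ^ 3 := by
    rw [hg, ← Real.rpow_natCast, ← Real.rpow_mul hΓ0.le, Real.rpow_neg hΓ0.le, one_div]
    norm_num
  have hε0 : 0 < ε := hε ▸ one_div_pos.2 hg0
  have hw : ∀ t ∈ Finset.Icc 1 T, ∀ τ ∈ Finset.Icc 1 Γ, ∀ s, w t τ s ∈ stdSimplex ℝ A₁ :=
    fun t ht τ hτ s => ((halg t ht s).1 τ hτ).1
  have hmax : ∀ t ∈ Finset.Icc 1 T, ∀ τ ∈ Finset.Icc 1 Γ, ∀ s,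
      IsMaxOn (leaderObj R ε (recentSum (M.qSeq π₁ π₂) t τ s + M.qSeq π₁ π₂ (t - 1) s))
        (stdSimplex ℝ A₁) (w t τ s) :=
    fun t ht τ hτ s => ((halg t ht s).1 τ hτ).2
  have hQ0 : M.qSeq π₁ π₂ 0 = 0 := rfl
  have hQ : ∀ t, 1 ≤ t → M.qSeq π₁ π₂ t = M.qValue (π₁ t) (π₂ t) := by
    intro t ht
    obtain ⟨n, rfl⟩ := Nat.exists_eq_add_of_le' ht
    rfl
  have hπ₁ : ∀ t ∈ Finset.Icc 1 T, IsPolicy (π₁ t) := by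
    intro t ht s
    rw [(halg t ht s).2, Finset.smul_sum]
    refine (convex_stdSimplex ℝ A₁).sum_mem (fun _ _ => by positivity) ?_
      fun τ hτ => hw t ht τ hτ s
    simp [hΓ0.ne']
  -- without any payoff the leader minimizes the regularizer
  have hb : BddBelow (R '' stdSimplex ℝ A₁) := by
    obtain ⟨s⟩ := ‹Nonempty S›
    refine ⟨R (w 1 1 s), ?_⟩
    rintro _ ⟨v, hv, rfl⟩
    have h : leaderObj R ε _ v ≤ leaderObj R ε _ (w 1 1 s) := hmax 1 m1 1 n1 s hv
    rw [recentSum_one_right] at h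
    simp only [leaderObj, Nat.sub_self, hQ0, Pi.zero_apply, add_zero, zero_dotProduct,
      zero_sub, neg_le_neg_iff] at h
    exact (div_le_div_iff_of_pos_right hε0).1 h
  have hρ₁0 : 0 ≤ ρ₁ := hρ₁ ▸ policyChange_nonneg T π₁
  have hρ₂0 : 0 ≤ ρ₂ := hρ₂ ▸ policyChange_nonneg T π₂
  have hI := M.influence₂_nonneg
  have hz := hω.one_sub_pos
  set z := 1 - Real.exp (-(1 / ω)) with hzdef
  have hz1 : 1 ≤ 1 / z := by
    rw [le_div_iff₀ hz]
    linarith [Real.exp_pos (-(1 / ω))]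
  have hdrift0 : 0 ≤ 6 * M.influence₂ * ρ₂ / z ^ 2 * T * Γ := by positivity
  refine csSup_le ⟨_, π₁ 1, hπ₁ 1 m1, rfl⟩ ?_
  rintro _ ⟨p, hp, rfl⟩
  rw [hg3]
  rcases subsingleton_or_nontrivial A₁ with hsub | hnon
  · -- with a single action there is only one policy
    have huniq : ∀ t ∈ Finset.Icc 1 T, p = π₁ t := by
      intro t ht
      ext s a
      have h1 := (hp s).2
      have h2 := (hπ₁ t ht s).2
      rw [Fintype.sum_subsingleton _ a] at h1 h2
      rw [h1, h2]
    rw [Finset.sum_eq_zero fun t ht => by rw [← huniq t ht, sub_self]]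
    have := regRange_nonneg hR hb
    positivity
  have hΔ := hR.half_le_regRange hb
  rcases (by omega : T = 1 ∨ 2 ≤ T) with rfl | hT
  · -- the regret of a single episode is at most `1 ≤ 2 Δ`
    obtain rfl : Γ = 1 := by omega
    have hg1 : g = 1 := by rw [hg]; simp
    rw [Finset.Icc_self, Finset.sum_singleton, hg1]
    have h1 := (hω.avgReward_mem hp (hπ₂ 1 m1)).2
    have h2 := (hω.avgReward_mem (hπ₁ 1 m1) (hπ₂ 1 m1)).1
    have h3 : 0 ≤ k ^ 2 * Cω ^ 2 := by positivity
    simp only [Nat.cast_one, mul_one, one_pow, div_one] at hdrift0 ⊢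
    linarith
  -- the bounds of the sensitivity analysis along the sequences of policies
  have hr₁ : ∀ t, 1 ≤ t → t + 1 ≤ T → rowNorm (π₁ (t + 1) - π₁ t) ≤ ρ₁ :=
    fun t h1 h2 => hρ₁ ▸ rowNorm_sub_le_policyChange π₁ h1 h2
  have hr₂ : ∀ t, 1 ≤ t → t + 1 ≤ T → rowNorm (π₂ (t + 1) - π₂ t) ≤ ρ₂ :=
    fun t h1 h2 => hρ₂ ▸ rowNorm_sub_le_policyChange π₂ h1 h2
  set C := cQ ω M.influence₂ ρ₁ ρ₂ with hC
  have hCexp : C = 3 * ((ρ₁ + M.influence₂ * ρ₂) / z ^ 2) + 2 * ((ρ₁ + ρ₂) / z)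
      + (3 * (1 / z) + 1) * ρ₁ + 2 * ρ₂ + (ρ₁ + M.influence₂ * ρ₂) / z := by
    rw [hC, cQ, cQPi, ← hzdef]
    ring
  have hC0 : 0 ≤ C := by rw [hCexp]; positivity
  have hCω0 : 0 ≤ Cω := (div_nonneg hC0 (le_max_of_le_left hρ₁0)).trans hCω
  have hCκ : C ≤ k * Cω * ε := by
    have hle : C ≤ Cω * max ρ₁ ρ₂ := by
      rcases (le_max_of_le_left hρ₁0 : 0 ≤ max ρ₁ ρ₂).eq_or_lt with h0 | hpos
      · have h1 : ρ₁ = 0 := le_antisymm (h0 ▸ le_max_left _ _) hρ₁0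
        have h2 : ρ₂ = 0 := le_antisymm (h0 ▸ le_max_right _ _) hρ₂0
        rw [← h0, hCexp, h1, h2]
        simp
      · exact (div_le_iff₀ hpos).1 hCω
    calc C ≤ Cω * max ρ₁ ρ₂ := hle
      _ ≤ Cω * (k * ε) := mul_le_mul_of_nonneg_left (max_le hkρ₁ hkρ₂) hCω0
      _ = _ := by ring
  have hKρ : (1 + 1 / z) * ρ₁ ≤ C := by
    rw [hCexp]
    have h1 : 0 ≤ 3 * ((ρ₁ + M.influence₂ * ρ₂) / z ^ 2) := by positivity
    have h2 : 0 ≤ 2 * ((ρ₁ + ρ₂) / z) := by positivity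
    have h3 : 0 ≤ (ρ₁ + M.influence₂ * ρ₂) / z := by positivity
    have h4 : 0 ≤ 1 / z * ρ₁ := by positivity
    linarith
  have hmem : ∀ t, 1 ≤ t → t + 1 ≤ T → t ∈ Finset.Icc 1 T ∧ t + 1 ∈ Finset.Icc 1 T :=
    fun t h1 h2 => ⟨Finset.mem_Icc.2 ⟨h1, by omega⟩, Finset.mem_Icc.2 ⟨by omega, h2⟩⟩
  have hmain := windowed_regret_le hR hb hε0 hT hΓ hQ0 hw hmax (fun t ht s => (halg t ht s).2)
    (d := fun t => M.statDist p (π₂ t)) (D := M.influence₂ * ρ₂ / z) (K := 1 + 1 / z) (C := C)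
    (ρ := ρ₁) (fun t ht => hω.statDist_mem hp (hπ₂ t ht)) (by positivity) (by positivity)
    (fun t h1 h2 => ?_) (fun t ht s a => ?_) (fun t h1 h2 s a => ?_) (hr₁ 1 le_rfl hT) hp
  · have hpd : ∀ t ∈ Finset.Icc 1 T, M.avgReward p (π₂ t) - M.avgReward (π₁ t) (π₂ t)
        = M.statDist p (π₂ t) ⬝ᵥ fun s => M.qSeq π₁ π₂ t s ⬝ᵥ (p s - π₁ t s) := by
      intro t ht
      rw [hω.avgReward_sub_eq hp (hπ₁ t ht) (hπ₂ t ht), hQ t (Finset.mem_Icc.1 ht).1]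
    rw [Finset.sum_congr rfl hpd]
    refine hmain.trans ?_
    have hnum := learning_rate_bound (T := T) (Δ := regRange R) (κ := k * Cω) hg0
      (by rw [hg4]; exact_mod_cast hΓT) hΔ
    rw [hg4, mul_pow k Cω, ← hε] at hnum
    have hsq : (T : ℝ) * (ε / 2 * C ^ 2) ≤ T * (ε / 2 * (k * Cω * ε) ^ 2) := by gcongr
    have hdr : 2 * (1 + 1 / z) * (M.influence₂ * ρ₂ / z) * T * Γ
        ≤ 6 * M.influence₂ * ρ₂ / z ^ 2 * T * Γ := by
      have h1 : 2 * (1 + 1 / z) * (M.influence₂ * ρ₂ / z)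
          ≤ 6 * (1 / z) * (M.influence₂ * ρ₂ / z) := by
        refine mul_le_mul_of_nonneg_right ?_ (by positivity)
        linarith
      calc _ ≤ 6 * (1 / z) * (M.influence₂ * ρ₂ / z) * T * Γ := by gcongr
        _ = _ := by field_simp
    linarith
  · obtain ⟨ht, ht'⟩ := hmem t h1 h2
    refine (hω.l1Norm_statDist_sub_le hp (hπ₂ _ ht') hp (hπ₂ t ht)).trans ?_
    have h0 : rowNorm (p - p) = 0 :=
      le_antisymm (rowNorm_le le_rfl fun s => by simp [l1Norm]) (rowNorm_nonneg _)
    rw [h0, zero_add]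
    exact div_le_div_of_nonneg_right (mul_le_mul_of_nonneg_left (hr₂ t h1 h2) hI) hz.le
  · rw [hQ t (Finset.mem_Icc.1 ht).1]
    exact hω.abs_qValue_le (hπ₁ t ht) (hπ₂ t ht) s a
  · obtain ⟨ht, ht'⟩ := hmem t h1 h2
    rw [hQ t h1, hQ (t + 1) (by omega)]
    exact hω.abs_qValue_sub_le (hπ₁ _ ht') (hπ₂ _ ht') (hπ₁ t ht) (hπ₂ t ht) (hr₁ t h1 h2)
      (hr₂ t h1 h2) s a
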